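/- All algorithms are deterministic Word-RAM programs with words of $O(\log N)$ bits ($N$ being the length of the input in words plus its largest entry), and running time is the worst-case number of executed instructions. The *$k$-cycle hypothesis* says: for every $\varepsilon>0$ there is some $k$ such that no $O(m^{2-\varepsilon})$-time algorithm decides whether a given directed graph with $m$ edges, presented by its list of edges, contains a $k$-cycle (distinct vertices $v_0,\dots,v_{k-1}$ with an edge from $v_i$ to $v_{i+1 \bmod k}$ for every $i$). A *unary $1$-VASS* $\mathcal V=(Q,T)$ consists of a non-empty finite set $Q$ of states and a non-empty set $T\subseteq Q\times\{-1,0,1\}\times Q$ of transitions; its size is $n=|Q|+|T|$. For a bound $B$, a configuration is a pair $q(v)$ with $q\in Q$ and $v\in\{0,\dots,B\}$; there is a step from $p(u)$ to $q(v)$ if $(p,v-u,q)\in T$, and a run is a finite sequence of configurations linked by steps. For a function $B(n)$, an instance of *reachability* (respectively *coverability*) in unary $(B(n),1)$-VASS consists of a unary $1$-VASS of size $n$ and two configurations $p(u)$, $q(v)$ with $u,v\in\{0,\dots,B(n)\}$; it asks whether there is a run, with all counter values in $\{0,\dots,B(n)\}$, from $p(u)$ to $q(v)$ (respectively to $q(v')$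 for some $v'\ge v$). The bound is not part of the input. **Theorem.** Assume the $k$-cycle hypothesis. Then for every rational constant $\gamma>0$ and every $\varepsilon>0$ there is no $O(n^{2-\varepsilon})$-time algorithm that decides reachability, and no $O(n^{2-\varepsilon})$-time algorithm that decides coverability, in unary $(\lfloor\gamma n\rfloor,1)$-VASS of size $n$. -/

import Mathlib

/-! ## Word-RAM -/

namespace WordRAM

/-- Unit-cost binary operations on words (`sub` is truncated at `0`; `shl`, `shr` are shifts). -/
inductive BinOp where
  | add | sub | mul | div | mod | and | or | xor | shl | shr

def BinOp.eval : BinOp → ℕ → ℕ → ℕ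
  | .add, a, b => a + b
  | .sub, a, b => a - b
  | .mul, a, b => a * b
  | .div, a, b => a / b
  | .mod, a, b => a % b
  | .and, a, b => a &&& b
  | .or, a, b => a ||| b
  | .xor, a, b => a ^^^ b
  | .shl, a, b => a <<< b
  | .shr, a, b => a >>> b

/-- Instructions. `R[·]` are the registers, `M[·]` is the random access memory.
A program mentions only finitely many registers. -/
inductive Instr where
  /-- `R[d] := v` -/
  | const (d v : ℕ)
  /-- `R[d] := o (R[a], R[b])` -/
  | binop (o : BinOp) (d a b : ℕ)
  /-- `R[d] := M[R[a]]` -/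
  | load (d a : ℕ)
  /-- `M[R[a]] := R[b]` -/
  | store (a b : ℕ)
  /-- continue with instruction number `l` -/
  | jump (l : ℕ)
  /-- continue with instruction number `l` if `R[a] = 0` -/
  | jumpZero (a l : ℕ)
  | accept
  | reject

/-- A (deterministic) program: a finite list of instructions. -/
abbrev Program := List Instr

/-- A machine state: program counter, registers, memory. -/
structure State where
  pc : ℕ
  reg : ℕ → ℕ
  mem : ℕ → ℕ

/-- Write `v` into register `d` and go to the next instruction. Registers hold `w`-bit words:
a value that does not fit into a word leaves the machine without a successor state. -/
def State.setReg (w : ℕ) (s : State) (d v : ℕ) : Option State :=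
  if v < 2 ^ w then some ⟨s.pc + 1, Function.update s.reg d v, s.mem⟩ else none

/-- Execute one instruction with `w`-bit words (`accept` and `reject` have no successor). -/
def Instr.exec (w : ℕ) (s : State) : Instr → Option State
  | .const d v => s.setReg w d v
  | .binop o d a b => s.setReg w d (o.eval (s.reg a) (s.reg b))
  | .load d a => s.setReg w d (s.mem (s.reg a))
  | .store a b => some ⟨s.pc + 1, s.reg, Function.update s.mem (s.reg a) (s.reg b)⟩
  | .jump l => some ⟨l, s.reg, s.mem⟩
  | .jumpZero a l => some ⟨if s.reg a = 0 then l else s.pc + 1, s.reg, s.mem⟩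
  | .accept => none
  | .reject => none

/-- `run P w t s = some b`: started in state `s`, the program `P` on a machine with `w`-bit words
halts after executing at most `t` instructions, with answer `b`. -/
def run (P : Program) (w : ℕ) : ℕ → State → Option Bool
  | 0, _ => none
  | t + 1, s =>
    match P[s.pc]? with
    | none => none
    | some .accept => some true
    | some .reject => some false
    | some i => (i.exec w s).bind (run P w t)

/-- Initial state: the input list is in the first memory cells, everything else is `0`. -/
def initial (L : List ℕ) : State := ⟨0, fun _ => 0, fun i => L.getD i 0⟩

/-- The number of bits needed to write down the length of the input plus its largest entry. -/
def inputBits (L : List ℕ) : ℕ := Nat.size (L.length + L.foldr max 0)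

end WordRAM

/-- A decision problem: a type of instances, how an instance is presented as a list of words, the
parameter in which running times are measured, and the yes-instances. -/
structure DecisionProblem where
  Inst : Type
  encode : Inst → List ℕ
  size : Inst → ℕ
  yes : Inst → Prop

/-- Some deterministic Word-RAM program with words of `O(log n)` bits decides the problem,
executing at most `T (size x)` instructions on every instance `x`. -/
def DecisionProblem.SolvableInTime (D : DecisionProblem) (T : ℕ → ℕ) : Prop :=
  ∃ (P : WordRAM.Program) (c : ℕ), ∀ x : D.Inst, ∃ b : Bool,
    WordRAM.run P (c * WordRAM.inputBits (D.encode x)) (T (D.size x))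
      (WordRAM.initial (D.encode x)) = some b ∧ (b = true ↔ D.yes x)

/-- The problem has an `O(n ^ a)`-time algorithm, `n` being the size of the instance. -/
def DecisionProblem.SolvableInTimeBigO (D : DecisionProblem) (a : ℝ) : Prop :=
  ∃ T : ℕ → ℕ,
    Asymptotics.IsBigO Filter.atTop (fun n : ℕ => (T n : ℝ)) (fun n : ℕ => (n : ℝ) ^ a) ∧
      D.SolvableInTime T

/-! ## Cycles in directed graphs -/

/-- A `k`-cycle: distinct vertices `c 0, …, c (k - 1)` with edges from `c i` to
`c (i + 1 mod k)`. -/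
def Digraph.HasKCycle {V : Type*} (G : Digraph V) (k : ℕ) : Prop :=
  ∃ c : Fin k → V, Function.Injective c ∧
    ∀ i j : Fin k, (j : ℕ) = ((i : ℕ) + 1) % k → G.Adj (c i) (c j)

/-- A directed graph on finitely many vertices together with the order in which its edges are
listed in the input. -/
structure GraphInput where
  numVertices : ℕ
  graph : Digraph (Fin numVertices)
  edges : List (Fin numVertices × Fin numVertices)
  nodup : edges.Nodup
  mem_edges : ∀ u v, (u, v) ∈ edges ↔ graph.Adj u v

/-- Number of vertices, number of edges, and the two endpoints of each edge. -/
def GraphInput.encode (x : GraphInput) : List ℕ :=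
  [x.numVertices, x.edges.length] ++ x.edges.flatMap fun e => [(e.1 : ℕ), (e.2 : ℕ)]

/-- Does a given directed graph contain a `k`-cycle? Measured in the number of edges. -/
def kCycleProblem (k : ℕ) : DecisionProblem where
  Inst := GraphInput
  encode := GraphInput.encode
  size x := x.edges.length
  yes x := x.graph.HasKCycle k

/-- The `k`-cycle hypothesis: for every `ε > 0` there is some `k` such that no
`O(m ^ (2 - ε))`-time algorithm finds `k`-cycles in directed graphs with `m` edges. -/
def KCycleHypothesis : Prop :=
  ∀ ε : ℝ, 0 < ε → ∃ k : ℕ, ¬ (kCycleProblem k).SolvableInTimeBigO (2 - ε)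

/-! ## Bounded unary VASS -/

/-- A unary `d`-dimensional vector addition system with states `Q`: a non-empty finite set of
transitions, all of whose updates are in `{-1, 0, 1}^d`. -/
structure UnaryVASS (d : ℕ) (Q : Type*) where
  trans : Finset (Q × (Fin d → ℤ) × Q)
  nonempty : trans.Nonempty
  unary : ∀ t ∈ trans, ∀ i, t.2.1 i = -1 ∨ t.2.1 i = 0 ∨ t.2.1 i = 1

namespace UnaryVASS

variable {d : ℕ} {Q : Type*}

/-- The size `|Q| + |T|`. -/
def size [Fintype Q] (V : UnaryVASS d Q) : ℕ := Fintype.card Q + V.trans.card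

/-- One step between configurations all of whose counter values are in `{0, …, B}`. -/
def BStep (V : UnaryVASS d Q) (B : ℕ) (c c' : Q × (Fin d → ℕ)) : Prop :=
  (∀ i, c.2 i ≤ B) ∧ (∀ i, c'.2 i ≤ B) ∧
    ∃ x : Fin d → ℤ, (c.1, x, c'.1) ∈ V.trans ∧ ∀ i, x i = (c'.2 i : ℤ) - (c.2 i : ℤ)

/-- There is a run from `c` to `c'` whose counter values stay in `{0, …, B}`. -/
def BReach (V : UnaryVASS d Q) (B : ℕ) (c c' : Q × (Fin d → ℕ)) : Prop :=
  Relation.ReflTransGen (V.BStep B) c c'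

end UnaryVASS

/-- An instance of reachability or coverability in unary `(B(n), d)`-VASS: a unary `d`-VASS of
some size `n`, an initial configuration and a target configuration with counter values in
`{0, …, B(n)}`, and the order in which the transitions are listed in the input. -/
structure BoundedVASSInput (B : ℕ → ℕ) (d : ℕ) where
  numStates : ℕ
  vass : UnaryVASS d (Fin numStates)
  source : Fin numStates × (Fin d → ℕ)
  target : Fin numStates × (Fin d → ℕ)
  source_le : ∀ i, source.2 i ≤ B vass.size
  target_le : ∀ i, target.2 i ≤ B vass.size
  transList : List (Fin numStates × (Fin d → ℤ) × Fin numStates)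
  nodup : transList.Nodup
  mem_transList : ∀ t, t ∈ transList ↔ t ∈ vass.trans

/-- Number of states, number of transitions, the two configurations, and the transitions, where
an update `-1`, `0`, `1` is written as `0`, `1`, `2`. -/
def BoundedVASSInput.encode {B : ℕ → ℕ} {d : ℕ} (x : BoundedVASSInput B d) : List ℕ :=
  [x.numStates, x.transList.length] ++
    ((x.source.1 : ℕ) :: List.ofFn x.source.2) ++ ((x.target.1 : ℕ) :: List.ofFn x.target.2) ++
    x.transList.flatMap fun t =>
      (t.1 : ℕ) :: (List.ofFn (fun i => (t.2.1 i + 1).toNat) ++ [(t.2.2 : ℕ)])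

/-- Reachability in unary `(B(n), d)`-VASS of size `n`; the bound is not part of the input. -/
def reachabilityProblem (B : ℕ → ℕ) (d : ℕ) : DecisionProblem where
  Inst := BoundedVASSInput B d
  encode := BoundedVASSInput.encode
  size x := x.vass.size
  yes x := x.vass.BReach (B x.vass.size) x.source x.target

/-- Coverability in unary `(B(n), d)`-VASS of size `n`; the bound is not part of the input. -/
def coverabilityProblem (B : ℕ → ℕ) (d : ℕ) : DecisionProblem where
  Inst := BoundedVASSInput B d
  encode := BoundedVASSInput.encode
  size x := x.vass.size
  yes x := ∃ v : Fin d → ℕ, (∀ i, x.target.2 i ≤ v i) ∧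
    x.vass.BReach (B x.vass.size) x.source (x.target.1, v)

/-- The linear counter bound `n ↦ ⌊γ n⌋`. -/
def linearBound (γ : ℚ) (n : ℕ) : ℕ := ⌊γ * (n : ℚ)⌋₊

/-! The reduction turns a graph with `m` edges into a VASS of size `m ^ (1 + o(1))`. Its counter
only has to remember where a walk started, so that the walk can be forced to close up after `k`
steps.

Vertices lying on edges get numbers below `R = 2 * m + 1`. The VASS has layers `0, …, k`, each with
one state for every pair of a colour `h` and a vertex `u`, at place `h * R + u` of the layer. Layer
`0` is a chain whose steps lower the counter, and layer `k` is a chain run backwards whose steps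
raise it. Every edge of the graph leads, without changing the counter, from each layer below `k` to
the next one with the same colour. Start at place `0` of layer `0` with the maximal value `B`. A run
that leaves layer `0` at place `a`, enters layer `k` at place `b` and goes back to place `0` ends
with value `B - a + b`. Ending with `B` means `a = b`, so the walk of length `k` is closed. As no
value exceeds `B`, covering the target is the same as reaching it, so one reduction serves both
problems (`Inv.step`, `Inv.closed_walk`, `reach_of_closed_walk`).

Distinctness of the vertices is enforced by derandomised colour coding. A colour chooses, for each
ordered pair of positions, a bit test that must give `0` at the first position and `1` at the
second. Vertices obeying one colour at different positions differ (`ne_of_badness_eq_zero`), any `k`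
distinct vertices obey some colour (`exists_colour`), and there are only polylogarithmically many
colours. Copies of edges that violate their colour lead to dead states instead of being omitted, so
the size depends on `k`, `m` and the denominator of `γ` alone. Unused states are added to make the
bound `⌊γ n⌋` at least as large as a layer (`le_bound`).

The rest makes this an algorithm. A small Hoare calculus (`Ex`, `wp`) verifies a program that writes
the instance behind the input (`ex_writeInstance`), and the assumed solver is then simulated in that
memory with shifted registers and addresses (`Represents.run`). Words stay logarithmic by
`wordFactor_spec`, and the layer size `O(m ^ (1 + δ))` turns an exponent `2 - ε` into `2 - ε / 2`
(`isBigO_time`), against the hypothesis. -/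

namespace WordRAM

/-! ### Composing program fragments -/

/-- `P` started in `s` behaves after `t` steps as if started in `s'`. -/
def Leads (P : Program) (w t : ℕ) (s s' : State) : Prop :=
  ∀ t', run P w (t + t') s = run P w t' s'

theorem Leads.refl (P : Program) (w : ℕ) (s : State) : Leads P w 0 s s := fun t' => by
  rw [Nat.zero_add]

theorem Leads.trans {P : Program} {w t₁ t₂ : ℕ} {s₁ s₂ s₃ : State} (h₁ : Leads P w t₁ s₁ s₂)
    (h₂ : Leads P w t₂ s₂ s₃) : Leads P w (t₁ + t₂) s₁ s₃ := fun t' => by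
  rw [Nat.add_assoc, h₁, h₂]

theorem Leads.step {P : Program} {w : ℕ} {s s' : State} {i : Instr} (hi : P[s.pc]? = some i)
    (he : i.exec w s = some s') : Leads P w 1 s s' := fun t' => by
  rw [Nat.add_comm, run, hi]
  cases i <;> first | exact congrArg (Option.bind · _) he | simp [Instr.exec] at he

theorem run_mono (P : Program) (w t t' : ℕ) (s : State) (b : Bool) (h : run P w t s = some b) :
    run P w (t + t') s = some b := by
  induction t generalizing s with
  | zero => simp [run] at h
  | succ t ih =>
    rw [Nat.add_right_comm, run]
    rw [run] at h
    split at h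
    · simp at h
    · exact h
    · exact h
    · rename_i i hA hR hi
      cases hx : i.exec w s with
      | none => rw [hx] at h; simp at h
      | some s' =>
        rw [hx] at h
        exact ih _ h

/-- Structured commands over straight-line blocks of instructions. -/
inductive Cmd where
  | block (l : List Instr)
  | seq (c₁ c₂ : Cmd)
  /-- repeat `c` as long as `R[a] ≠ 0` -/
  | loop (a : ℕ) (c : Cmd)

/-- Number of instructions of the compiled command. -/
def Cmd.len : Cmd → ℕ
  | .block l => l.length
  | .seq c₁ c₂ => c₁.len + c₂.len
  | .loop _ c => c.len + 2

/-- The instructions implementing a command that starts at instruction number `o`. -/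
def Cmd.compile : Cmd → ℕ → List Instr
  | .block l, _ => l
  | .seq c₁ c₂, o => c₁.compile o ++ c₂.compile (o + c₁.len)
  | .loop a c, o => .jumpZero a (o + c.len + 2) :: (c.compile (o + 1) ++ [.jump o])

theorem Cmd.length_compile (c : Cmd) (o : ℕ) : (c.compile o).length = c.len := by
  induction c generalizing o with
  | block l => rfl
  | seq c₁ c₂ h₁ h₂ => simp [compile, len, h₁, h₂]
  | loop a c h => simp [compile, len, h]

/-- The register an instruction may write to. -/
def Instr.writes : Instr → List ℕ
  | .const d _ => [d]
  | .binop _ d _ _ => [d]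
  | .load d _ => [d]
  | _ => []

/-- The registers a command may write to. -/
def Cmd.writes : Cmd → List ℕ
  | .block l => l.flatMap Instr.writes
  | .seq c₁ c₂ => c₁.writes ++ c₂.writes
  | .loop _ c => c.writes

/-- The instructions `l` stand in `P` from instruction number `o` on. -/
def CodeAt (P : Program) (o : ℕ) (l : List Instr) : Prop :=
  ∀ i, i < l.length → P[o + i]? = l[i]?

theorem CodeAt.left {P : Program} {o : ℕ} {l₁ l₂ : List Instr} (h : CodeAt P o (l₁ ++ l₂)) :
    CodeAt P o l₁ := fun i hi => by
  rw [h i (by simp; omega), List.getElem?_append_left hi]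

theorem CodeAt.right {P : Program} {o : ℕ} {l₁ l₂ : List Instr} (h : CodeAt P o (l₁ ++ l₂)) :
    CodeAt P (o + l₁.length) l₂ := fun i hi => by
  rw [Nat.add_assoc, h _ (by simp; omega), List.getElem?_append_right (by omega)]
  simp

theorem CodeAt.head {P : Program} {o : ℕ} {i : Instr} {l : List Instr}
    (h : CodeAt P o (i :: l)) : P[o]? = some i := by
  simpa using h 0 (by simp)

theorem CodeAt.tail {P : Program} {o : ℕ} {i : Instr} {l : List Instr}
    (h : CodeAt P o (i :: l)) : CodeAt P (o + 1) l :=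
  CodeAt.right (l₁ := [i]) h

/-- Started with registers `r` and memory `m`, the command `c` ends within `t` steps, with
registers and memory satisfying `Q`; registers outside `c.writes` keep their values. -/
def Ex (w : ℕ) (c : Cmd) (t : ℕ) (r m : ℕ → ℕ) (Q : (ℕ → ℕ) → (ℕ → ℕ) → Prop) : Prop :=
  ∀ (P : Program) (o : ℕ), CodeAt P o (c.compile o) → ∃ t' ≤ t, ∃ r' m', Q r' m' ∧
    (∀ d, d ∉ c.writes → r' d = r d) ∧ Leads P w t' ⟨o, r, m⟩ ⟨o + c.len, r', m'⟩

theorem Ex.mono {w : ℕ} {c : Cmd} {t t' : ℕ} {r m : ℕ → ℕ} {Q Q' : (ℕ → ℕ) → (ℕ → ℕ) → Prop}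
    (h : Ex w c t r m Q) (ht : t ≤ t')
    (hQ : ∀ r' m', (∀ d, d ∉ c.writes → r' d = r d) → Q r' m' → Q' r' m') :
    Ex w c t' r m Q' := fun P o hP => by
  obtain ⟨t₁, ht₁, r', m', hq, hf, hl⟩ := h P o hP
  exact ⟨t₁, ht₁.trans ht, r', m', hQ r' m' hf hq, hf, hl⟩

theorem Ex.seq {w : ℕ} {c₁ c₂ : Cmd} {t₁ t₂ : ℕ} {r m : ℕ → ℕ}
    {Q₁ Q₂ : (ℕ → ℕ) → (ℕ → ℕ) → Prop} (h₁ : Ex w c₁ t₁ r m Q₁)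
    (h₂ : ∀ r' m', (∀ d, d ∉ c₁.writes → r' d = r d) → Q₁ r' m' → Ex w c₂ t₂ r' m' Q₂) :
    Ex w (c₁.seq c₂) (t₁ + t₂) r m Q₂ := fun P o hP => by
  obtain ⟨t₁', ht₁, r₁, m₁, hq₁, hf₁, hl₁⟩ := h₁ P o hP.left
  have hP₂ := hP.right
  rw [Cmd.length_compile] at hP₂
  obtain ⟨t₂', ht₂, r₂, m₂, hq₂, hf₂, hl₂⟩ := h₂ r₁ m₁ hf₁ hq₁ P _ hP₂
  refine ⟨t₁' + t₂', by omega, r₂, m₂, hq₂, fun d hd => ?_, ?_⟩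
  · simp only [Cmd.writes, List.mem_append, not_or] at hd
    rw [hf₂ d hd.2, hf₁ d hd.1]
  · have := hl₁.trans hl₂
    rwa [Nat.add_assoc] at this

/-- A loop that makes `n` rounds of at most `t` steps each. -/
theorem Ex.loop {w : ℕ} {a : ℕ} {c : Cmd} {t n : ℕ} {r m : ℕ → ℕ}
    (I : ℕ → (ℕ → ℕ) → (ℕ → ℕ) → Prop) (h₀ : I n r m)
    (hz : ∀ r' m', I 0 r' m' → r' a = 0)
    (hs : ∀ i r' m', i < n → I (i + 1) r' m' → (∀ d, d ∉ c.writes → r' d = r d) →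
      r' a ≠ 0 ∧ Ex w c t r' m' (I i)) :
    Ex w (.loop a c) (n * (t + 2) + 1) r m (I 0) := fun P o hP => by
  have key : ∀ i ≤ n, ∀ r₁ m₁, I i r₁ m₁ → (∀ d, d ∉ c.writes → r₁ d = r d) →
      ∃ t' ≤ i * (t + 2) + 1, ∃ r' m', I 0 r' m' ∧
      (∀ d, d ∉ c.writes → r' d = r d) ∧
        Leads P w t' ⟨o, r₁, m₁⟩ ⟨o + (c.len + 2), r', m'⟩ := by
    intro i
    induction i with
    | zero =>
      intro _ r₁ m₁ hI hf
      refine ⟨1, by omega, r₁, m₁, hI, hf, Leads.step hP.head ?_⟩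
      simp [Instr.exec, hz _ _ hI, Nat.add_assoc]
    | succ i ih =>
      intro hi r₁ m₁ hI hf
      obtain ⟨hne, hx⟩ := hs i r₁ m₁ hi hI hf
      obtain ⟨t₁, ht₁, r₂, m₂, hI₂, hf₂, hl₂⟩ := hx P (o + 1) hP.tail.left
      obtain ⟨t₃, ht₃, r₃, m₃, hI₃, hf₃, hl₃⟩ := ih (by omega) r₂ m₂ hI₂
        fun d hd => (hf₂ d hd).trans (hf d hd)
      have h₁ : Leads P w 1 ⟨o, r₁, m₁⟩ ⟨o + 1, r₁, m₁⟩ :=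
        Leads.step hP.head (by simp [Instr.exec, hne])
      have h₂ : Leads P w 1 ⟨o + 1 + c.len, r₂, m₂⟩ ⟨o, r₂, m₂⟩ := by
        have := hP.tail.right
        rw [Cmd.length_compile] at this
        exact Leads.step this.head rfl
      refine ⟨1 + t₁ + 1 + t₃, ?_, r₃, m₃, hI₃, hf₃, ((h₁.trans hl₂).trans h₂).trans hl₃⟩
      rw [Nat.succ_mul]
      omega
  exact key n le_rfl r m h₀ fun _ _ => rfl

/-- Weakest precondition of a straight-line block. -/
def wp (w : ℕ) : List Instr → ((ℕ → ℕ) → (ℕ → ℕ) → Prop) → (ℕ → ℕ) → (ℕ → ℕ) → Prop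
  | [], Q, r, m => Q r m
  | .const d v :: l, Q, r, m => v < 2 ^ w ∧ wp w l Q (Function.update r d v) m
  | .binop o d a b :: l, Q, r, m =>
    o.eval (r a) (r b) < 2 ^ w ∧ wp w l Q (Function.update r d (o.eval (r a) (r b))) m
  | .load d a :: l, Q, r, m => m (r a) < 2 ^ w ∧ wp w l Q (Function.update r d (m (r a))) m
  | .store a b :: l, Q, r, m => wp w l Q r (Function.update m (r a) (r b))
  | _ :: _, _, _, _ => False

theorem Ex.block {w : ℕ} {l : List Instr} {r m : ℕ → ℕ} {Q : (ℕ → ℕ) → (ℕ → ℕ) → Prop}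
    (h : wp w l Q r m) : Ex w (.block l) l.length r m Q := fun P o hP => by
  refine ⟨l.length, le_rfl, ?_⟩
  change CodeAt P o l at hP
  change ∃ r' m', Q r' m' ∧ (∀ d, d ∉ l.flatMap Instr.writes → r' d = r d) ∧
    Leads P w l.length ⟨o, r, m⟩ ⟨o + l.length, r', m'⟩
  induction l generalizing r m o with
  | nil => exact ⟨r, m, h, fun _ _ => rfl, Leads.refl _ _ _⟩
  | cons i l ih =>
    have key : ∀ r₁ m₁, i.exec w ⟨o, r, m⟩ = some ⟨o + 1, r₁, m₁⟩ →
        (∀ d, d ∉ i.writes → r₁ d = r d) → wp w l Q r₁ m₁ →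
        ∃ r' m', Q r' m' ∧ (∀ d, d ∉ (i :: l).flatMap Instr.writes → r' d = r d) ∧
          Leads P w (i :: l).length ⟨o, r, m⟩ ⟨o + (i :: l).length, r', m'⟩ := by
      intro r₁ m₁ he hf hw
      obtain ⟨r₂, m₂, hq, hf₂, hl⟩ := ih hw (o + 1) hP.tail
      refine ⟨r₂, m₂, hq, fun d hd => ?_, ?_⟩
      · simp only [List.flatMap_cons, List.mem_append, not_or] at hd
        rw [hf₂ d hd.2, hf d hd.1]
      · have := (Leads.step (s := ⟨o, r, m⟩) hP.head he).trans hl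
        rwa [Nat.add_comm 1, Nat.add_assoc, Nat.add_comm 1] at this
    cases i with
    | const d v =>
      refine key _ _ (by simp [Instr.exec, State.setReg, h.1]) (fun x hx => ?_) h.2
      simp only [Instr.writes, List.mem_singleton] at hx
      simp [hx]
    | binop b d a₁ a₂ =>
      refine key _ _ (by simp [Instr.exec, State.setReg, h.1]) (fun x hx => ?_) h.2
      simp only [Instr.writes, List.mem_singleton] at hx
      simp [hx]
    | load d a =>
      refine key _ _ (by simp [Instr.exec, State.setReg, h.1]) (fun x hx => ?_) h.2
      simp only [Instr.writes, List.mem_singleton] at hx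
      simp [hx]
    | store a b => exact key _ _ rfl (fun _ _ => rfl) h
    | jump l => exact h.elim
    | jumpZero a l => exact h.elim
    | accept => exact h.elim
    | reject => exact h.elim

theorem Leads.step_step {P : Program} {w : ℕ} {s s' : State} {i j : Instr} {r m : ℕ → ℕ}
    (hc : CodeAt P s.pc [i, j]) (h₁ : i.exec w s = some ⟨s.pc + 1, r, m⟩)
    (h₂ : j.exec w ⟨s.pc + 1, r, m⟩ = some s') : Leads P w 2 s s' :=
  Leads.trans (t₁ := 1) (t₂ := 1) (Leads.step hc.head h₁)
    (Leads.step (s := ⟨s.pc + 1, r, m⟩) hc.tail.head h₂)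

/-! ### Running a program inside a shifted memory -/

/-- Simulation of one instruction at instruction number `p`: registers are shifted by `r₀`, memory
is shifted by the content of register `b`, instruction `l` is found at `o + 2 * l`, and register
`a₀` holds addresses. -/
def Instr.shift (o r₀ b a₀ p : ℕ) : Instr → List Instr
  | .const d v => [.const (r₀ + d) v, .jump (o + 2 * (p + 1))]
  | .binop x d a c => [.binop x (r₀ + d) (r₀ + a) (r₀ + c), .jump (o + 2 * (p + 1))]
  | .load d a => [.binop .add a₀ b (r₀ + a), .load (r₀ + d) a₀]
  | .store a c => [.binop .add a₀ b (r₀ + a), .store a₀ (r₀ + c)]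
  | .jump l => [.jump (o + 2 * l), .reject]
  | .jumpZero a l => [.jumpZero (r₀ + a) (o + 2 * l), .jump (o + 2 * (p + 1))]
  | .accept => [.accept, .reject]
  | .reject => [.reject, .reject]

/-- The simulation of a program; `p` is the number of its first instruction. -/
def Program.shift (o r₀ b a₀ : ℕ) : ℕ → Program → Program
  | _, [] => []
  | p, i :: l => i.shift o r₀ b a₀ p ++ Program.shift o r₀ b a₀ (p + 1) l

theorem Instr.length_shift (o r₀ b a₀ p : ℕ) (i : Instr) :
    (i.shift o r₀ b a₀ p).length = 2 := by cases i <;> rfl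

/-- Every instruction is replaced by exactly two, with padding where needed, so jump targets can be
translated without knowing the program. -/
theorem CodeAt.shift {P' : Program} {o r₀ b a₀ p : ℕ} {P : Program}
    (h : CodeAt P' (o + 2 * p) (Program.shift o r₀ b a₀ p P)) (n : ℕ) (i : Instr)
    (hi : P[n]? = some i) : CodeAt P' (o + 2 * (p + n)) (i.shift o r₀ b a₀ (p + n)) := by
  induction P generalizing p n with
  | nil => simp at hi
  | cons j P ih =>
    cases n with
    | zero =>
      simp only [List.getElem?_cons_zero, Option.some.injEq] at hi
      subst hi
      exact h.left
    | succ n =>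
      have h' := h.right
      rw [Instr.length_shift] at h'
      have := ih (p := p + 1) (by rwa [Nat.mul_add, ← Nat.add_assoc]) n (by simpa using hi)
      rwa [Nat.add_assoc, Nat.add_comm 1] at this

/-- `s'` represents `s` in the simulation, all words of `s` having `w` bits. -/
structure Represents (o r₀ b β w : ℕ) (s s' : State) : Prop where
  pc : s'.pc = o + 2 * s.pc
  reg : ∀ d, s'.reg (r₀ + d) = s.reg d
  base : s'.reg b = β
  mem : ∀ a, s'.mem (β + a) = s.mem a
  small : ∀ d, s.reg d < 2 ^ w

theorem Represents.setReg {o r₀ b β w : ℕ} {s s' : State} (h : Represents o r₀ b β w s s')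
    (hb : b < r₀) {d v : ℕ} (hv : v < 2 ^ w) :
    Represents o r₀ b β w ⟨s.pc + 1, Function.update s.reg d v, s.mem⟩
      ⟨o + 2 * (s.pc + 1), Function.update s'.reg (r₀ + d) v, s'.mem⟩ where
  pc := rfl
  reg e := by
    by_cases hd : e = d
    · simp [hd]
    · simp only
      rw [Function.update_of_ne (by omega), Function.update_of_ne hd, h.reg]
  base := by
    simp only
    rw [Function.update_of_ne (by omega), h.base]
  mem := h.mem
  small e := by
    by_cases hd : e = d
    · simpa [hd] using hv
    · simpa [hd] using h.small e

theorem Represents.setAddress {o r₀ b β w : ℕ} {s s' : State} (h : Represents o r₀ b β w s s')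
    {a₀ v : ℕ} (ha : a₀ < r₀) (hab : a₀ ≠ b) :
    Represents o r₀ b β w s ⟨s'.pc, Function.update s'.reg a₀ v, s'.mem⟩ where
  pc := h.pc
  reg e := by
    simp only
    rw [Function.update_of_ne (by omega), h.reg]
  base := by
    simp only
    rw [Function.update_of_ne (by omega), h.base]
  mem := h.mem
  small := h.small

/-- Only instructions that succeed with `w`-bit words are simulated, so no fault has to be imitated.
The condition `hw` makes the shifted address `β + R[a]` fit into a word of the larger machine; this
is why representation records that all registers of `s` are small. -/
theorem Represents.step {P' : Program} {o r₀ b a₀ β w w' : ℕ} {s s' t : State} {i : Instr}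
    (hb : b < r₀) (ha : a₀ < r₀) (hab : a₀ ≠ b) (hw : β + 2 ^ w ≤ 2 ^ w')
    (h : Represents o r₀ b β w s s') (hc : CodeAt P' s'.pc (i.shift o r₀ b a₀ s.pc))
    (hi : i.exec w s = some t) :
    ∃ n ≤ 2, ∃ t', Represents o r₀ b β w t t' ∧ Leads P' w' n s' t' := by
  have hlen : ∀ (v : ℕ), v < 2 ^ w → v < 2 ^ w' := fun v hv => by omega
  cases i with
  | const d v =>
    simp only [Instr.exec, State.setReg, Option.ite_none_right_eq_some, Option.some.injEq] at hi
    obtain ⟨hv, rfl⟩ := hi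
    refine ⟨2, le_rfl, _, h.setReg hb hv, ?_⟩
    refine Leads.step_step (r := Function.update s'.reg (r₀ + d) v) (m := s'.mem) hc ?_ ?_
    · exact if_pos (hlen _ hv)
    · rfl
  | binop x d a c =>
    simp only [Instr.exec, State.setReg, Option.ite_none_right_eq_some, Option.some.injEq] at hi
    obtain ⟨hv, rfl⟩ := hi
    refine ⟨2, le_rfl, _, h.setReg hb hv, ?_⟩
    refine Leads.step_step (r := Function.update s'.reg (r₀ + d) (x.eval (s.reg a) (s.reg c)))
        (m := s'.mem) hc ?_ ?_
    · simp only [Instr.exec, h.reg]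
      exact if_pos (hlen _ hv)
    · rfl
  | load d a =>
    simp only [Instr.exec, State.setReg, Option.ite_none_right_eq_some, Option.some.injEq] at hi
    obtain ⟨hv, rfl⟩ := hi
    refine ⟨2, le_rfl, _, (h.setAddress (v := β + s.reg a) ha hab).setReg hb hv, ?_⟩
    refine Leads.step_step (r := Function.update s'.reg a₀ (β + s.reg a)) (m := s'.mem) hc ?_ ?_
    · simp only [Instr.exec, h.reg, h.base, BinOp.eval]
      refine if_pos ?_
      have := h.small a
      omega
    · simp only [Instr.exec, Function.update_self, h.mem]
      refine (if_pos (hlen _ hv)).trans ?_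
      simp only [h.pc, Nat.mul_add, Nat.add_assoc]
  | store a c =>
    simp only [Instr.exec, Option.some.injEq] at hi
    subst hi
    have h₁ := h.setAddress (v := β + s.reg a) ha hab
    refine ⟨2, le_rfl, ⟨o + 2 * (s.pc + 1), Function.update s'.reg a₀ (β + s.reg a),
      Function.update s'.mem (β + s.reg a) (s.reg c)⟩, ⟨rfl, h₁.reg, h₁.base, fun e => ?_,
        h.small⟩, ?_⟩
    · by_cases he : e = s.reg a
      · simp [he]
      · simp only
        rw [Function.update_of_ne (by omega), Function.update_of_ne he, h.mem]
    refine Leads.step_step (r := Function.update s'.reg a₀ (β + s.reg a)) (m := s'.mem) hc ?_ ?_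
    · simp only [Instr.exec, h.reg, h.base, BinOp.eval]
      refine if_pos ?_
      have := h.small a
      omega
    · have := h₁.reg c
      simp only at this
      simp only [Instr.exec, Function.update_self, this, h.pc, Nat.mul_add, Nat.add_assoc]
  | jump l =>
    simp only [Instr.exec, Option.some.injEq] at hi
    subst hi
    exact ⟨1, by omega, ⟨o + 2 * l, s'.reg, s'.mem⟩, ⟨rfl, h.reg, h.base, h.mem, h.small⟩,
      Leads.step hc.head rfl⟩
  | jumpZero a l =>
    simp only [Instr.exec, Option.some.injEq] at hi
    subst hi
    by_cases hz : s.reg a = 0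
    · refine ⟨1, by omega, ⟨o + 2 * l, s'.reg, s'.mem⟩,
        ⟨by simp [hz], h.reg, h.base, h.mem, h.small⟩, Leads.step hc.head ?_⟩
      simp [Instr.exec, h.reg, hz]
    · refine ⟨2, by omega, ⟨o + 2 * (s.pc + 1), s'.reg, s'.mem⟩,
        ⟨by simp [hz], h.reg, h.base, h.mem, h.small⟩, ?_⟩
      refine Leads.step_step (r := s'.reg) (m := s'.mem) hc ?_ ?_
      · simp [Instr.exec, h.reg, hz]
      · rfl
  | accept => simp [Instr.exec] at hi
  | reject => simp [Instr.exec] at hi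

theorem Represents.run {P P' : Program} {o r₀ b a₀ β w w' : ℕ} (hb : b < r₀) (ha : a₀ < r₀)
    (hab : a₀ ≠ b) (hw : β + 2 ^ w ≤ 2 ^ w') (hP : CodeAt P' o (Program.shift o r₀ b a₀ 0 P))
    {t : ℕ} {s s' : State} (h : Represents o r₀ b β w s s') {x : Bool}
    (hr : run P w t s = some x) : WordRAM.run P' w' (2 * t) s' = some x := by
  induction t generalizing s s' with
  | zero => simp [WordRAM.run] at hr
  | succ t ih =>
    rw [WordRAM.run] at hr
    have hcode : ∀ i, P[s.pc]? = some i → CodeAt P' s'.pc (i.shift o r₀ b a₀ s.pc) := by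
      intro i hi
      have := CodeAt.shift (p := 0) (by simpa using hP) s.pc i hi
      rwa [Nat.zero_add, ← h.pc] at this
    split at hr
    · simp at hr
    · rename_i hi
      rw [Nat.mul_succ, WordRAM.run, (hcode _ hi).head]
      exact hr
    · rename_i hi
      rw [Nat.mul_succ, WordRAM.run, (hcode _ hi).head]
      exact hr
    · rename_i i hA hR hi
      obtain ⟨u, hu, hr⟩ := Option.bind_eq_some_iff.1 hr
      obtain ⟨n, hn, u', hrep, hl⟩ := h.step hb ha hab hw (hcode i hi) hu
      have := ih hrep hr
      -- A jump costs one step instead of two; the unused step is returned as slack.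
      have h2 := run_mono P' w' _ (2 - n) _ _ this
      rw [← hl] at h2
      rw [← h2]
      congr 1
      omega

end WordRAM

namespace CycleReduction

/-! ### A small family of colour codings -/

/-- The bit test number `d`: bit number `d / 2`, negated for odd `d`. -/
def bitTest (d v : ℕ) : ℕ := (v >>> (d / 2) + d) % 2

theorem bitTest_lt_two (d v : ℕ) : bitTest d v < 2 := Nat.mod_lt _ two_pos

/-- Distinct numbers below `R` differ in one of the lowest `R.size` bits, and the parity of `d`
chooses the polarity that sends `u` to `0`. For `u = v` any bit will do. -/
theorem exists_bitTest {R u v : ℕ} (hR : 0 < R) (hu : u < R) (hv : v < R) :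
    ∃ d < 2 * R.size, bitTest d u = 0 ∧ (u ≠ v → bitTest d v = 1) := by
  have hpos : 0 < R.size := Nat.size_pos.2 hR
  have key : ∀ i < R.size, ∃ d < 2 * R.size, d / 2 = i ∧ bitTest d u = 0 := by
    intro i hi
    rcases Nat.mod_two_eq_zero_or_one (u >>> i) with h | h
    · refine ⟨2 * i, by omega, by omega, ?_⟩
      have : 2 * i / 2 = i := by omega
      rw [bitTest, this]
      omega
    · refine ⟨2 * i + 1, by omega, by omega, ?_⟩
      have : (2 * i + 1) / 2 = i := by omega
      rw [bitTest, this]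
      omega
  by_cases huv : u = v
  · obtain ⟨d, hd, -, h⟩ := key 0 hpos
    exact ⟨d, hd, h, fun h' => (h' huv).elim⟩
  · obtain ⟨i, hi⟩ : ∃ i, u.testBit i ≠ v.testBit i := by
      by_contra! h
      exact huv (Nat.eq_of_testBit_eq h)
    have hR2 : R < 2 ^ R.size := Nat.lt_size_self R
    have hlt : i < R.size := by
      by_contra! hge
      have : 2 ^ R.size ≤ 2 ^ i := Nat.pow_le_pow_right two_pos hge
      rw [Nat.testBit_lt_two_pow (by omega), Nat.testBit_lt_two_pow (by omega)] at hi
      exact hi rfl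
    obtain ⟨d, hd, hdi, h⟩ := key i hlt
    refine ⟨d, hd, h, fun _ => ?_⟩
    have hne : u >>> i % 2 ≠ v >>> i % 2 := by
      intro h'
      apply hi
      simp only [Nat.testBit, Nat.one_and_eq_mod_two, h']
    rw [bitTest, hdi] at h ⊢
    omega

/-- Does putting `v` on position `j` violate the requirement number `p`, which tells the vertices
on the positions `p / k` and `p % k` apart by the bit test `d`? -/
def violation (k j v d p : ℕ) : ℕ :=
  (1 - (j ^^^ (p / k))) * bitTest d v +
    ((1 - (j ^^^ (p % k))) - (1 - (j ^^^ (p / k)))) * (1 - bitTest d v)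

/-- Number of violations when `v` is put on position `j`; the bit tests are the base-`D` digits of
the colour `h`. -/
def badness (k D j v : ℕ) : ℕ → ℕ → ℕ
  | 0, _ => 0
  | p + 1, h => violation k j v (h % D) p + badness k D j v p (h / D)

/-- The tests `d` are the digits of `h` and do not depend on `j` or `v`. Thus two vertices on
different positions are judged by the same tests. -/
theorem badness_digits (k D : ℕ) (K h : ℕ) :
    ∃ d : ℕ → ℕ, ∀ j v, badness k D j v K h = 0 → ∀ p < K, violation k j v (d p) p = 0 := by
  induction K generalizing h with
  | zero => exact ⟨fun _ => 0, fun _ _ _ p hp => by omega⟩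
  | succ K ih =>
    obtain ⟨d, hd⟩ := ih (h / D)
    refine ⟨Function.update d K (h % D), fun j v hb p hp => ?_⟩
    rw [badness] at hb
    by_cases hpK : p = K
    · subst hpK
      rw [Function.update_self]
      omega
    · rw [Function.update_of_ne hpK]
      exact hd j v (by omega) p (by omega)

/-- The converse of reading off digits: `h` is assembled from prescribed tests, with the last one as
its lowest digit because `badness` consumes requirements from the top. -/
theorem exists_badness_eq_zero (k D : ℕ) (K : ℕ) (d : ℕ → ℕ) (hd : ∀ p < K, d p < D) :
    ∃ h < D ^ K, ∀ j v, (∀ p < K, violation k j v (d p) p = 0) → badness k D j v K h = 0 := by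
  induction K with
  | zero => exact ⟨0, by simp, fun _ _ _ => rfl⟩
  | succ K ih =>
    obtain ⟨h, hh, hv⟩ := ih fun p hp => hd p (by omega)
    have hdK := hd K (by omega)
    refine ⟨d K + D * h, ?_, fun j v hp => ?_⟩
    · calc d K + D * h < D * (h + 1) := by rw [Nat.mul_succ]; omega
        _ ≤ D * D ^ K := Nat.mul_le_mul_left _ hh
        _ = D ^ (K + 1) := by rw [pow_succ']
    · rw [badness, Nat.add_mul_mod_self_left, Nat.mod_eq_of_lt hdK,
        Nat.add_mul_div_left _ _ (by omega), Nat.div_eq_of_lt hdK, Nat.zero_add,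
        hp K (by omega), hv j v fun p hp' => hp p (by omega)]

/-- With truncated subtraction, `1 - (a ^^^ b)` is the indicator of `a = b`. Such arithmetic
replaces branching, which the structured commands do not offer. -/
theorem one_sub_xor_self (a : ℕ) : 1 - (a ^^^ a) = 1 := by simp

theorem one_sub_xor_of_ne {a b : ℕ} (h : a ≠ b) : 1 - (a ^^^ b) = 0 := by
  have : a ^^^ b ≠ 0 := fun h' => h (Nat.xor_eq_zero_iff.1 h')
  omega

/-- The requirement number `i * k + j` demands that its test gives `0` for `u` and `1` for `v`. -/
theorem ne_of_badness_eq_zero {k D h i j u v : ℕ} (hi : i < k) (hj : j < k) (hij : i ≠ j)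
    (hu : badness k D i u (k * k) h = 0) (hv : badness k D j v (k * k) h = 0) : u ≠ v := by
  obtain ⟨d, hd⟩ := badness_digits k D (k * k) h
  have hp : i * k + j < k * k := by
    calc i * k + j < (i + 1) * k := by rw [Nat.succ_mul]; omega
      _ ≤ k * k := Nat.mul_le_mul_right _ hi
  have h1 := hd i u hu _ hp
  have h2 := hd j v hv _ hp
  have hdiv : (i * k + j) / k = i := by
    rw [Nat.mul_comm, Nat.mul_add_div (by omega), Nat.div_eq_of_lt hj, Nat.add_zero]
  have hmod : (i * k + j) % k = j := by
    rw [Nat.mul_comm, Nat.mul_add_mod, Nat.mod_eq_of_lt hj]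
  rw [violation, hdiv, hmod, one_sub_xor_self, one_sub_xor_of_ne hij] at h1
  rw [violation, hdiv, hmod, one_sub_xor_self, one_sub_xor_of_ne hij.symm] at h2
  rintro rfl
  omega

/-- For each ordered pair of positions a test separating the two vertices is chosen, and these
choices are packed into one number. On the diagonal `p / k = p % k` only the value `0` is demanded,
since the second term of `violation` is truncated away. -/
theorem exists_colour {k R : ℕ} (c : ℕ → ℕ) (hR : ∀ i < k, c i < R)
    (hc : ∀ i < k, ∀ j < k, i ≠ j → c i ≠ c j) :
    ∃ h < (2 * R.size) ^ (k * k), ∀ j < k, badness k (2 * R.size) j (c j) (k * k) h = 0 := by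
  have hex : ∀ p, ∃ d, p < k * k → d < 2 * R.size ∧ bitTest d (c (p / k)) = 0 ∧
      (c (p / k) ≠ c (p % k) → bitTest d (c (p % k)) = 1) := by
    intro p
    by_cases hp : p < k * k
    · have hk : 0 < k := by
        rcases Nat.eq_zero_or_pos k with rfl | h
        · omega
        · exact h
      have h1 := hR (p / k) (Nat.div_lt_of_lt_mul hp)
      have h2 := hR (p % k) (Nat.mod_lt _ hk)
      obtain ⟨d, hd⟩ := exists_bitTest (by omega) h1 h2
      exact ⟨d, fun _ => hd⟩
    · exact ⟨0, fun h => (hp h).elim⟩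
  choose d hd using hex
  obtain ⟨h, hh, hb⟩ := exists_badness_eq_zero k (2 * R.size) (k * k) d fun p hp => (hd p hp).1
  refine ⟨h, hh, fun j hj => hb j _ fun p hp => ?_⟩
  obtain ⟨-, h0, h1⟩ := hd p hp
  rw [violation]
  by_cases ha : j = p / k
  · rw [← ha, one_sub_xor_self]
    rw [← ha] at h0
    have : (1 - (j ^^^ (p % k))) - 1 = 0 := by omega
    rw [this, h0]
  · rw [one_sub_xor_of_ne ha]
    by_cases hb : j = p % k
    · rw [← hb, one_sub_xor_self]
      rw [← hb] at h1
      rw [h1 fun h' => hc j hj (p / k) (Nat.div_lt_of_lt_mul hp) ha h'.symm]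
    · rw [one_sub_xor_of_ne hb]
      omega

/-! ### The transitions -/

/-- The data of the reduction: cycle length, denominator of the counter bound, number of edges, and
the end points of every edge, as numbers below `2 * m + 1`. -/
structure Params where
  k : ℕ
  q : ℕ
  m : ℕ
  eu : ℕ → ℕ
  ev : ℕ → ℕ
  k_pos : 0 < k
  eu_lt : ∀ i < m, eu i < 2 * m + 1
  ev_lt : ∀ i < m, ev i < 2 * m + 1
  inj : ∀ i < m, ∀ j < m, eu i = eu j → ev i = ev j → i = j

/-- Two polarities for each bit of a vertex number; a colour then has one base-`numTests` digit per
ordered pair of positions. -/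
def numTests (m : ℕ) : ℕ := 2 * (2 * m + 1).size
def numColours (k m : ℕ) : ℕ := numTests m ^ (k * k)
/-- Number of states in a layer. -/
def layer (k m : ℕ) : ℕ := numColours k m * (2 * m + 1)
-- There are `k + 1` live layers and equally many dead ones, into which violating edges are
-- diverted. The `q` further layers are isolated and only enlarge the size, hence the counter bound.
def stateCount (k q m : ℕ) : ℕ := (2 * k + 2 + q) * layer k m
def transCount (k m : ℕ) : ℕ := (layer k m - 1) * 2 + k * numColours k m * m

theorem numTests_pos (m : ℕ) : 1 < numTests m := by
  have : 0 < (2 * m + 1).size := Nat.size_pos.2 (by omega)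
  rw [numTests]
  omega

theorem numColours_gt_one {k : ℕ} (hk : 0 < k) (m : ℕ) : 1 < numColours k m :=
  Nat.one_lt_pow (by positivity) (numTests_pos m)

theorem layer_gt_one {k : ℕ} (hk : 0 < k) (m : ℕ) : 1 < layer k m :=
  lt_of_lt_of_le (numColours_gt_one hk m) (Nat.le_mul_of_pos_right _ (by omega))

namespace Params

variable (x : Params)

/-- The two counting transitions between the states `g` and `g + 1` of the first and of the last
layer (an update `-1`, `0`, `1` is written as `0`, `1`, `2`). -/
def chain (g : ℕ) : List (ℕ × ℕ × ℕ) :=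
  [(g, 0, g + 1), (x.k * layer x.k x.m + (g + 1), 2, x.k * layer x.k x.m + g)]

/-- The double truncated subtraction caps the number of violations at `1`. The number `s` packs a
layer and a colour as `layer * numColours + colour`. -/
def isBad (s e : ℕ) : ℕ :=
  1 - (1 - badness x.k (numTests x.m) (s / numColours x.k x.m) (x.ev e) (x.k * x.k)
    (s % numColours x.k x.m))

/-- The copy of the edge `e` for the layer and colour given by `s`. -/
def edge (s e : ℕ) : ℕ × ℕ × ℕ :=
  (s * (2 * x.m + 1) + x.eu e, 1, (s + numColours x.k x.m) * (2 * x.m + 1) + x.ev e +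
    x.isBad s e * ((x.k + 1) * layer x.k x.m))

/-- The ranges are reversed because the loops that write these lists count down to zero. -/
def triples : List (ℕ × ℕ × ℕ) :=
  (List.range (layer x.k x.m - 1)).reverse.flatMap x.chain ++
    (List.range (x.k * numColours x.k x.m * x.m)).reverse.map fun t => x.edge (t / x.m) (t % x.m)

theorem mem_triples (t : ℕ × ℕ × ℕ) : t ∈ x.triples ↔
    (∃ g, g + 1 < layer x.k x.m ∧ t = (g, 0, g + 1)) ∨
    (∃ g, g + 1 < layer x.k x.m ∧
      t = (x.k * layer x.k x.m + (g + 1), 2, x.k * layer x.k x.m + g)) ∨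
    ∃ s e, s < x.k * numColours x.k x.m ∧ e < x.m ∧ t = x.edge s e := by
  have hG := layer_gt_one x.k_pos x.m
  simp only [triples, List.mem_append, List.mem_flatMap, List.mem_reverse, List.mem_range, chain,
    List.mem_cons, List.not_mem_nil, or_false, List.mem_map]
  constructor
  · rintro (⟨g, hg, h | h⟩ | ⟨t', ht', h⟩)
    · exact Or.inl ⟨g, by omega, h⟩
    · exact Or.inr (Or.inl ⟨g, by omega, h⟩)
    · have hm : 0 < x.m := by
        rcases Nat.eq_zero_or_pos x.m with h0 | h0
        · rw [h0] at ht'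
          omega
        · exact h0
      exact Or.inr (Or.inr ⟨t' / x.m, t' % x.m, Nat.div_lt_of_lt_mul (by rwa [Nat.mul_comm]),
        Nat.mod_lt _ hm, h.symm⟩)
  · rintro (⟨g, hg, h⟩ | ⟨g, hg, h⟩ | ⟨s, e, hs, he, h⟩)
    · exact Or.inl ⟨g, by omega, Or.inl h⟩
    · exact Or.inl ⟨g, by omega, Or.inr h⟩
    · refine Or.inr ⟨s * x.m + e, ?_, ?_⟩
      · calc s * x.m + e < (s + 1) * x.m := by rw [Nat.succ_mul]; omega
          _ ≤ _ := Nat.mul_le_mul_right _ hs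
      · rw [h, Nat.mul_comm s, Nat.mul_add_div (by omega), Nat.div_eq_of_lt he, Nat.mul_add_mod,
          Nat.mod_eq_of_lt he, Nat.add_zero]

theorem length_triples : x.triples.length = transCount x.k x.m := by
  simp [triples, chain, transCount]

theorem mul_add_inj {R a b u v : ℕ} (hu : u < R) (hv : v < R) (h : a * R + u = b * R + v) :
    a = b ∧ u = v := by
  have h1 : (a * R + u) / R = a := by
    rw [Nat.mul_comm, Nat.mul_add_div (by omega), Nat.div_eq_of_lt hu, Nat.add_zero]
  have h2 : (b * R + v) / R = b := by
    rw [Nat.mul_comm, Nat.mul_add_div (by omega), Nat.div_eq_of_lt hv, Nat.add_zero]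
  have hab : a = b := by rw [← h1, h, h2]
  subst hab
  exact ⟨rfl, by omega⟩

/-- A state with colour and vertex `u < 2 * m + 1` in one of the first layers. -/
theorem lt_layer {a s u : ℕ} (hs : s < a * numColours x.k x.m) (hu : u < 2 * x.m + 1) :
    s * (2 * x.m + 1) + u < a * layer x.k x.m := by
  calc s * (2 * x.m + 1) + u < (s + 1) * (2 * x.m + 1) := by rw [Nat.succ_mul s]; omega
    _ ≤ a * numColours x.k x.m * (2 * x.m + 1) := Nat.mul_le_mul_right _ hs
    _ = _ := by rw [layer, Nat.mul_assoc]

theorem edge_lt {s e : ℕ} (hs : s < x.k * numColours x.k x.m) (he : e < x.m) :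
    (x.edge s e).2.2 < (2 * x.k + 2) * layer x.k x.m := by
  have h := x.lt_layer (a := x.k + 1) (s := s + numColours x.k x.m)
    (by rw [Nat.succ_mul]; omega) (x.ev_lt e he)
  have hb : x.isBad s e ≤ 1 := by rw [isBad]; omega
  have hb' := Nat.mul_le_mul_right ((x.k + 1) * layer x.k x.m) hb
  have : (2 * x.k + 2) * layer x.k x.m =
    (x.k + 1) * layer x.k x.m + (x.k + 1) * layer x.k x.m := by ring
  simp only [edge]
  omega

theorem triples_lt {t : ℕ × ℕ × ℕ} (ht : t ∈ x.triples) :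
    t.1 < stateCount x.k x.q x.m ∧ t.2.1 ≤ 2 ∧ t.2.2 < stateCount x.k x.q x.m := by
  have e1 : stateCount x.k x.q x.m = (2 * x.k + 2) * layer x.k x.m + x.q * layer x.k x.m := by
    rw [stateCount]; ring
  have e2 : (2 * x.k + 2) * layer x.k x.m =
    x.k * layer x.k x.m + x.k * layer x.k x.m + 2 * layer x.k x.m := by ring
  rcases (x.mem_triples t).1 ht with ⟨g, hg, rfl⟩ | ⟨g, hg, rfl⟩ | ⟨s, e, hs, he, rfl⟩
  · simp only
    omega
  · simp only
    omega
  · have h1 := x.edge_lt hs he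
    have h2 := x.lt_layer hs (x.eu_lt e he)
    refine ⟨?_, ?_, by omega⟩
    · simp only [edge]
      omega
    · simp [edge]

/-- The source of an edge copy determines `s` and the tail vertex, its target modulo `(k + 1) *
layer` the head vertex, and `inj` then gives the edge. Chain transitions are told apart from edge
copies by their update. -/
theorem nodup_triples : x.triples.Nodup := by
  have hG := layer_gt_one x.k_pos x.m
  have hkG : layer x.k x.m ≤ x.k * layer x.k x.m := Nat.le_mul_of_pos_left _ x.k_pos
  have hm : ∀ t < x.k * numColours x.k x.m * x.m, 0 < x.m := by
    intro t ht
    rcases Nat.eq_zero_or_pos x.m with h0 | h0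
    · rw [h0] at ht
      omega
    · exact h0
  rw [triples, List.nodup_append']
  refine ⟨?_, ?_, ?_⟩
  · rw [List.nodup_flatMap]
    refine ⟨fun g _ => by simp [chain], ?_⟩
    refine List.Pairwise.imp_of_mem ?_ (List.nodup_reverse.2 List.nodup_range)
    intro a b _ _ hab
    simp only [Function.onFun, chain, List.disjoint_cons_left, List.mem_cons, Prod.mk.injEq,
      List.not_mem_nil, or_false]
    refine ⟨by omega, by omega, by simp⟩
  · refine List.Nodup.map_on ?_ (List.nodup_reverse.2 List.nodup_range)
    intro a ha b hb hab
    simp only [List.mem_reverse, List.mem_range] at ha hb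
    have hm0 := hm a ha
    have ia := Nat.mod_lt a hm0
    have ib := Nat.mod_lt b hm0
    have sa : a / x.m < x.k * numColours x.k x.m := Nat.div_lt_of_lt_mul (by rwa [Nat.mul_comm])
    have sb : b / x.m < x.k * numColours x.k x.m := Nat.div_lt_of_lt_mul (by rwa [Nat.mul_comm])
    simp only [edge, Prod.mk.injEq, true_and] at hab
    obtain ⟨h1, h2⟩ := hab
    obtain ⟨hs, hu⟩ := mul_add_inj (x.eu_lt _ ia) (x.eu_lt _ ib) h1
    have ba : x.isBad (a / x.m) (a % x.m) ≤ 1 := by rw [isBad]; omega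
    have bb : x.isBad (b / x.m) (b % x.m) ≤ 1 := by rw [isBad]; omega
    have la := x.lt_layer (a := x.k + 1) (s := a / x.m + numColours x.k x.m)
      (by rw [Nat.succ_mul]; omega) (x.ev_lt _ ia)
    have lb := x.lt_layer (a := x.k + 1) (s := b / x.m + numColours x.k x.m)
      (by rw [Nat.succ_mul]; omega) (x.ev_lt _ ib)
    -- The diversion flag becomes the leading digit in base `(k + 1) * layer`, so uniqueness of
    -- division with remainder strips it off.
    rw [Nat.add_comm _ (_ * ((x.k + 1) * _)), Nat.add_comm _ (_ * ((x.k + 1) * _))] at h2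
    obtain ⟨-, h3⟩ := mul_add_inj la lb h2
    obtain ⟨-, hv⟩ := mul_add_inj (x.ev_lt _ ia) (x.ev_lt _ ib) h3
    have hi := x.inj _ ia _ ib hu hv
    rw [← Nat.div_add_mod a x.m, ← Nat.div_add_mod b x.m, hs, hi]
  · simp only [List.disjoint_left, List.mem_flatMap, List.mem_map, List.mem_reverse, chain,
      List.mem_cons, List.not_mem_nil, or_false]
    rintro t ⟨g, hg, rfl | rfl⟩ ⟨t, ht, h⟩ <;> simp [edge] at h

/-! ### Runs -/

/-- A step between configurations with counter values at most `B`. -/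
def Step (B : ℕ) (c c' : ℕ × ℕ) : Prop :=
  ∃ b, (c.1, b, c'.1) ∈ x.triples ∧ c'.2 + 1 = c.2 + b ∧ c.2 ≤ B ∧ c'.2 ≤ B

/-- `w` is a walk of length `j` all of whose vertices fit the colour `h`. -/
def Walk (h j : ℕ) (w : ℕ → ℕ) : Prop :=
  w 0 < 2 * x.m + 1 ∧ ∀ i < j, ∃ e < x.m, x.eu e = w i ∧ x.ev e = w (i + 1) ∧
    badness x.k (numTests x.m) i (w (i + 1)) (x.k * x.k) h = 0

variable {x}

theorem Walk.lt {h j : ℕ} {w : ℕ → ℕ} (hw : x.Walk h j w) {i : ℕ} (hi : i ≤ j) :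
    w i < 2 * x.m + 1 := by
  cases i with
  | zero => exact hw.1
  | succ i =>
    obtain ⟨e, he, -, h, -⟩ := hw.2 i hi
    rw [← h]
    exact x.ev_lt e he

theorem Walk.extend {h j : ℕ} {w : ℕ → ℕ} (hw : x.Walk h j w) {e : ℕ} (he : e < x.m)
    (hu : x.eu e = w j) (hb : badness x.k (numTests x.m) j (x.ev e) (x.k * x.k) h = 0) :
    x.Walk h (j + 1) (Function.update w (j + 1) (x.ev e)) := by
  refine ⟨by rw [Function.update_of_ne (by omega)]; exact hw.1, fun i hi => ?_⟩
  by_cases hij : i = j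
  · subst hij
    exact ⟨e, he, by rw [Function.update_of_ne (by omega), hu], by simp, by simpa using hb⟩
  · obtain ⟨e', he', h'⟩ := hw.2 i (by omega)
    refine ⟨e', he', ?_⟩
    rwa [Function.update_of_ne (by omega), Function.update_of_ne (by omega)]

variable (x)

/-- What holds for the configurations reachable from state `0` and counter value `B`. -/
def Inv (B : ℕ) (c : ℕ × ℕ) : Prop :=
  (∃ j h w, j < x.k ∧ h < numColours x.k x.m ∧ x.Walk h j w ∧
    c.1 = (j * numColours x.k x.m + h) * (2 * x.m + 1) + w j ∧
      c.2 + (h * (2 * x.m + 1) + w 0) = B) ∨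
  (∃ h w g, h < numColours x.k x.m ∧ x.Walk h x.k w ∧ c.1 = x.k * layer x.k x.m + g ∧
    g ≤ h * (2 * x.m + 1) + w x.k ∧
      c.2 + (h * (2 * x.m + 1) + w 0) + g = B + (h * (2 * x.m + 1) + w x.k)) ∨
  (x.k + 1) * layer x.k x.m ≤ c.1

/-- The layers occupy disjoint intervals of state numbers, so the three kinds of transitions can be
matched with the three alternatives. Dead states have no outgoing transitions, since every source is
below `(k + 1) * layer`. -/
theorem Inv.step {B : ℕ} {c c' : ℕ × ℕ} (h : x.Inv B c) (hs : x.Step B c c') : x.Inv B c' := by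
  obtain ⟨s, v⟩ := c
  obtain ⟨s', v'⟩ := c'
  obtain ⟨b, hb, hv, -, hB⟩ := hs
  simp only at hb hv hB
  have hkG : layer x.k x.m ≤ x.k * layer x.k x.m := Nat.le_mul_of_pos_left _ x.k_pos
  have hk1 : (x.k + 1) * layer x.k x.m = x.k * layer x.k x.m + layer x.k x.m := by ring
  have hmid : ∀ j h' u, j < x.k → h' < numColours x.k x.m → u < 2 * x.m + 1 →
      (j * numColours x.k x.m + h') * (2 * x.m + 1) + u < x.k * layer x.k x.m := by
    intro j h' u hj hh hu
    refine x.lt_layer ?_ hu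
    calc j * numColours x.k x.m + h' < (j + 1) * numColours x.k x.m := by
          rw [Nat.succ_mul]; omega
      _ ≤ _ := Nat.mul_le_mul_right _ hj
  rcases (x.mem_triples _).1 hb with ⟨g, hg, he⟩ | ⟨g, hg, he⟩ | ⟨t, e, ht, hem, he⟩
  · simp only [Prod.mk.injEq] at he
    obtain ⟨rfl, rfl, rfl⟩ := he
    rcases h with ⟨j, h, w, hj, hh, hw, h1, h2⟩ | ⟨h, w, g', -, -, h1, -⟩ | h1
    · simp only at h1 h2
      -- Lowering transitions start below `layer`, whereas states of later layers have numbers at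
      -- least `layer`.
      have hj0 : j = 0 := by
        by_contra hj0
        have : numColours x.k x.m ≤ j * numColours x.k x.m + h :=
          (Nat.le_mul_of_pos_left _ (by omega)).trans (Nat.le_add_right _ _)
        have := Nat.mul_le_mul_right (2 * x.m + 1) this
        rw [← layer] at this
        omega
      subst hj0
      rw [Nat.zero_mul, Nat.zero_add] at h1
      have hlt : (s + 1) / (2 * x.m + 1) < numColours x.k x.m :=
        Nat.div_lt_of_lt_mul (by rw [Nat.mul_comm]; exact hg)
      -- A walk of length `0` obeys every colour, so inside the first layer both the colour and the
      -- start vertex may be replaced.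
      refine Or.inl ⟨0, (s + 1) / (2 * x.m + 1), fun _ => (s + 1) % (2 * x.m + 1), hj, hlt,
        ⟨Nat.mod_lt _ (by omega), fun i hi => by omega⟩, ?_, ?_⟩
      · simp only [Nat.zero_mul, Nat.zero_add]
        rw [Nat.mul_comm, Nat.div_add_mod]
      · simp only
        rw [Nat.mul_comm, Nat.div_add_mod]
        omega
    · simp only at h1
      omega
    · simp only at h1
      omega
  · simp only [Prod.mk.injEq] at he
    obtain ⟨rfl, rfl, rfl⟩ := he
    rcases h with ⟨j, h, w, hj, hh, hw, h1, h2⟩ | ⟨h, w, g', hh, hw, h1, h2, h3⟩ | h1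
    · simp only at h1
      have := hmid j h _ hj hh (hw.lt le_rfl)
      omega
    · simp only at h1 h3
      exact Or.inr (Or.inl ⟨h, w, g, hh, hw, rfl, by omega, by simp only; omega⟩)
    · simp only at h1
      omega
  · simp only [edge, Prod.mk.injEq] at he
    obtain ⟨rfl, rfl, rfl⟩ := he
    have hlt := x.lt_layer ht (x.eu_lt e hem)
    rcases h with ⟨j, h, w, hj, hh, hw, h1, h2⟩ | ⟨h, w, g', hh, hw, h1, h2, h3⟩ | h1
    · simp only at h1 h2
      obtain ⟨rfl, hu⟩ := mul_add_inj (x.eu_lt e hem) (hw.lt le_rfl) h1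
      by_cases hbad : x.isBad (j * numColours x.k x.m + h) e = 0
      · rw [hbad, Nat.zero_mul, Nat.add_zero]
        have hz : badness x.k (numTests x.m) j (x.ev e) (x.k * x.k) h = 0 := by
          rw [isBad, Nat.mul_comm, Nat.mul_add_div (by omega), Nat.div_eq_of_lt hh,
            Nat.mul_add_mod, Nat.mod_eq_of_lt hh, Nat.add_zero] at hbad
          omega
        have hw' := hw.extend hem hu hz
        have hend : Function.update w (j + 1) (x.ev e) (j + 1) = x.ev e := by simp
        have h0 : Function.update w (j + 1) (x.ev e) 0 = w 0 :=
          Function.update_of_ne (by omega) _ _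
        have hst : j * numColours x.k x.m + h + numColours x.k x.m =
          (j + 1) * numColours x.k x.m + h := by ring
        by_cases hjk : j + 1 < x.k
        · refine Or.inl ⟨j + 1, h, _, hjk, hh, hw', ?_, ?_⟩
          · rw [hend, hst]
          · rw [h0]
            simp only
            omega
        · have hjk' : j + 1 = x.k := by omega
          rw [hjk'] at hw' hend h0 hst
          refine Or.inr (Or.inl ⟨h, _, h * (2 * x.m + 1) + x.ev e, hh, hw', ?_, ?_, ?_⟩)
          · simp only
            rw [hst, layer]
            ring
          · rw [hend]
          · rw [h0, hend]
            simp only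
            omega
      -- A violating copy is shifted by at least `(k + 1) * layer` and lands in the dead part.
      · have : 1 ≤ x.isBad (j * numColours x.k x.m + h) e := by omega
        have := Nat.mul_le_mul_right ((x.k + 1) * layer x.k x.m) this
        refine Or.inr (Or.inr ?_)
        simp only
        omega
    · simp only at h1
      omega
    · simp only at h1
      omega

theorem Inv.start {B : ℕ} : x.Inv B (0, B) := by
  refine Or.inl ⟨0, 0, fun _ => 0, x.k_pos, ?_, ⟨Nat.succ_pos _, fun i hi => by omega⟩, by simp,
    by simp⟩
  have := numColours_gt_one x.k_pos x.m
  omega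

/-- At place `0` of the last layer the invariant reads `v + a = B + b`, where `a` and `b` encode the
two ends of the walk with the same colour. The two inequalities for `v` force `a = b`. -/
theorem Inv.closed_walk {B v : ℕ} (hv : B ≤ v) (hB : v ≤ B)
    (h : x.Inv B (x.k * layer x.k x.m, v)) :
    ∃ h w, x.Walk h x.k w ∧ w 0 = w x.k := by
  have hG := layer_gt_one x.k_pos x.m
  have hk1 : (x.k + 1) * layer x.k x.m = x.k * layer x.k x.m + layer x.k x.m := by ring
  rcases h with ⟨j, h, w, hj, hh, hw, h1, h2⟩ | ⟨h, w, g', hh, hw, h1, h2, h3⟩ | h1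
  · simp only at h1
    have := x.lt_layer (a := x.k) (s := j * numColours x.k x.m + h) (by
      calc j * numColours x.k x.m + h < (j + 1) * numColours x.k x.m := by
            rw [Nat.succ_mul]; omega
        _ ≤ _ := Nat.mul_le_mul_right _ hj) (hw.lt le_rfl)
    omega
  · simp only at h1 h3
    exact ⟨h, w, hw, by omega⟩
  · simp only at h1
    omega

/-- Descend to the place `g` of the start vertex, follow the walk at constant value `B - g`, and
climb back from the same place. By `hB` the counter does not run out, because `g < layer`. -/
theorem reach_of_closed_walk {B h : ℕ} {w : ℕ → ℕ} (hB : layer x.k x.m ≤ B)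
    (hh : h < numColours x.k x.m) (hw : x.Walk h x.k w) (hc : w 0 = w x.k) :
    Relation.ReflTransGen (x.Step B) (0, B) (x.k * layer x.k x.m, B) := by
  set R := 2 * x.m + 1 with hR
  have hg : h * R + w 0 < layer x.k x.m := by
    have := x.lt_layer (a := 1) (by simpa using hh) (hw.lt (Nat.zero_le _))
    simpa using this
  set g := h * R + w 0 with hgdef
  have h1 : ∀ i ≤ g, Relation.ReflTransGen (x.Step B) (0, B) (i, B - i) := by
    intro i
    induction i with
    | zero => exact fun _ => Relation.ReflTransGen.refl
    | succ i ih =>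
      intro hi
      refine (ih (by omega)).tail
        ⟨0, (x.mem_triples _).2 (Or.inl ⟨i, by omega, rfl⟩), ?_⟩
      simp only
      omega
  have h2 : ∀ j ≤ x.k, Relation.ReflTransGen (x.Step B) (0, B)
      ((j * numColours x.k x.m + h) * R + w j, B - g) := by
    intro j
    induction j with
    | zero =>
      intro _
      rw [Nat.zero_mul, Nat.zero_add]
      exact h1 g le_rfl
    | succ j ih =>
      intro hj
      obtain ⟨e, he, hu, hv, hb⟩ := hw.2 j hj
      refine (ih (by omega)).tail ⟨1, (x.mem_triples _).2 (Or.inr (Or.inr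
        ⟨j * numColours x.k x.m + h, e, ?_, he, ?_⟩)), ?_⟩
      · calc j * numColours x.k x.m + h < (j + 1) * numColours x.k x.m := by
              rw [Nat.succ_mul]; omega
          _ ≤ _ := Nat.mul_le_mul_right _ hj
      · have hbad : x.isBad (j * numColours x.k x.m + h) e = 0 := by
          rw [isBad, Nat.mul_comm, Nat.mul_add_div (by omega), Nat.div_eq_of_lt hh,
            Nat.mul_add_mod, Nat.mod_eq_of_lt hh, Nat.add_zero, hv, hb]
        rw [edge, hbad, hu, hv, ← hR]
        simp only [Prod.mk.injEq, true_and]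
        ring
      · exact ⟨rfl, Nat.sub_le _ _, Nat.sub_le _ _⟩
  have h3 : ∀ i ≤ g, Relation.ReflTransGen (x.Step B) (0, B)
      (x.k * layer x.k x.m + (g - i), B - (g - i)) := by
    intro i
    induction i with
    | zero =>
      intro _
      have := h2 x.k le_rfl
      rw [← hc] at this
      convert this using 1
      refine Prod.ext ?_ rfl
      simp only
      rw [layer, Nat.sub_zero, hgdef]
      ring
    | succ i ih =>
      intro hi
      refine (ih (by omega)).tail
        ⟨2, (x.mem_triples _).2 (Or.inr (Or.inl ⟨g - (i + 1), by omega, ?_⟩)), ?_⟩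
      · simp only [Prod.mk.injEq, and_true]
        omega
      · simp only
        omega
  simpa using h3 g le_rfl

end Params

open WordRAM

/-! ### The graph -/

/-- The end points of all edges, as they are listed in the input. -/
def endpoints (g : GraphInput) : List ℕ := g.edges.flatMap fun e => [(e.1 : ℕ), (e.2 : ℕ)]

theorem getD_flatMap_pair {α : Type*} (f f' : α → ℕ) (l : List α) (i : ℕ) (hi : i < l.length) :
    (l.flatMap fun e => [f e, f' e]).getD (2 * i) 0 = f l[i] ∧
      (l.flatMap fun e => [f e, f' e]).getD (2 * i + 1) 0 = f' l[i] := by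
  induction l generalizing i with
  | nil => simp at hi
  | cons a l ih =>
    cases i with
    | zero => simp
    | succ i =>
      have := ih i (by simpa using hi)
      have h2 : 2 * (i + 1) = 2 * i + 1 + 1 := by omega
      simpa [h2] using this

theorem length_flatMap_pair {α : Type*} (f f' : α → ℕ) (l : List α) :
    (l.flatMap fun e => [f e, f' e]).length = 2 * l.length := by
  simp [Nat.mul_comm]

theorem length_endpoints (g : GraphInput) : (endpoints g).length = 2 * g.edges.length :=
  length_flatMap_pair _ _ _

/-- The function `id` numbers the vertices that lie on edges. -/
structure Numbering (g : GraphInput) (id : ℕ → ℕ) : Prop where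
  lt : ∀ i < 2 * g.edges.length, id ((endpoints g).getD i 0) < 2 * g.edges.length
  inv : ∀ i < 2 * g.edges.length,
    (endpoints g).getD (id ((endpoints g).getD i 0)) 0 = (endpoints g).getD i 0

/-- The data of the reduction for the graph `g`. -/
def params (g : GraphInput) {id : ℕ → ℕ} (hid : Numbering g id) {k : ℕ} (hk : 0 < k) (q : ℕ) :
    Params where
  k := k
  q := q
  m := g.edges.length
  eu i := id ((endpoints g).getD (2 * i) 0)
  ev i := id ((endpoints g).getD (2 * i + 1) 0)
  k_pos := hk
  eu_lt i hi := (hid.lt (2 * i) (by omega)).trans (Nat.lt_succ_self _)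
  ev_lt i hi := (hid.lt (2 * i + 1) (by omega)).trans (Nat.lt_succ_self _)
  inj i hi j hj hu hv := by
    have h1 := congrArg (fun n => (endpoints g).getD n 0) hu
    have h2 := congrArg (fun n => (endpoints g).getD n 0) hv
    rw [hid.inv _ (by omega), hid.inv _ (by omega)] at h1 h2
    have ei := getD_flatMap_pair (fun e => (e.1 : ℕ)) (fun e => (e.2 : ℕ)) g.edges i hi
    have ej := getD_flatMap_pair (fun e => (e.1 : ℕ)) (fun e => (e.2 : ℕ)) g.edges j hj
    have h1' := ei.1.symm.trans (h1.trans ej.1)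
    have h2' := ei.2.symm.trans (h2.trans ej.2)
    exact (List.Nodup.getElem_inj_iff g.nodup).1 (Prod.ext (Fin.ext h1') (Fin.ext h2'))

section

variable {g : GraphInput} {id : ℕ → ℕ} (hid : Numbering g id) {k : ℕ} (hk : 0 < k) (q : ℕ)

/-- The `i`-th vertex of the cycle is the head of the `i`-th edge, which the colour tests at
position `i`. Consecutive edges meet since vertex numbers can be decoded through `Numbering.inv`,
and the last edge meets the first by `hc`. -/
theorem hasKCycle_of_closed_walk {h : ℕ} {w : ℕ → ℕ} (hw : (params g hid hk q).Walk h k w)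
    (hc : w 0 = w k) : g.graph.HasKCycle k := by
  have hstep : ∀ i < k, ∃ e : Fin g.numVertices × Fin g.numVertices, e ∈ g.edges ∧
      w i = id e.1 ∧ w (i + 1) = id e.2 ∧ (endpoints g).getD (w i) 0 = e.1 ∧
        (endpoints g).getD (w (i + 1)) 0 = e.2 := by
    intro i hi
    obtain ⟨e, he, hu, hv, -⟩ := hw.2 i hi
    change e < g.edges.length at he
    change id ((endpoints g).getD (2 * e) 0) = _ at hu
    change id ((endpoints g).getD (2 * e + 1) 0) = _ at hv
    have h1 := hid.inv (2 * e) (by omega)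
    have h2 := hid.inv (2 * e + 1) (by omega)
    have he' := getD_flatMap_pair (fun e => (e.1 : ℕ)) (fun e => (e.2 : ℕ)) g.edges e he
    have e1 : (endpoints g).getD (2 * e) 0 = g.edges[e].1 := he'.1
    have e2 : (endpoints g).getD (2 * e + 1) 0 = g.edges[e].2 := he'.2
    rw [hu, e1] at h1
    rw [hv, e2] at h2
    rw [e1] at hu
    rw [e2] at hv
    exact ⟨g.edges[e], List.getElem_mem he, hu.symm, hv.symm, h1, h2⟩
  choose e he hu hv hiu hiv using hstep
  refine ⟨fun i => (e i i.2).2, fun i j hij => ?_, fun i j hij => ?_⟩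
  · by_contra hne
    have hbad : ∀ i < k, badness k (numTests g.edges.length) i (w (i + 1)) (k * k) h = 0 := by
      intro i hi
      obtain ⟨_, _, _, _, hb⟩ := hw.2 i hi
      exact hb
    refine ne_of_badness_eq_zero i.2 j.2 (fun h => hne (Fin.ext h)) (hbad i i.2) (hbad j j.2) ?_
    rw [hv i i.2, hv j j.2]
    exact congrArg (fun v => id (Fin.val v)) hij
  · have h1 : (e i i.2).2 = (e j j.2).1 := by
      apply Fin.ext
      rw [← hiv i i.2, ← hiu j j.2]
      congr 1
      rw [hij]
      by_cases hik : (i : ℕ) + 1 < k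
      · rw [Nat.mod_eq_of_lt hik]
      · have : (i : ℕ) + 1 = k := by omega
        rw [this, Nat.mod_self, hc]
    simp only [h1]
    exact (g.mem_edges _ _).1 (he j j.2)

/-- A cycle, once its vertices are numbered, is a closed walk; the numbers stay distinct because the
numbering is injective on vertices lying on edges. -/
theorem exists_closed_walk (hg : g.graph.HasKCycle k) :
    ∃ h < numColours k g.edges.length, ∃ w, (params g hid hk q).Walk h k w ∧ w 0 = w k := by
  obtain ⟨c, hinj, hadj⟩ := hg
  have hlt : ∀ i, (i + k - 1) % k < k := fun i => Nat.mod_lt _ hk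
  have hedge : ∀ i, ∃ e < g.edges.length,
      (endpoints g).getD (2 * e) 0 = c ⟨(i + k - 1) % k, hlt i⟩ ∧
      (endpoints g).getD (2 * e + 1) 0 = c ⟨(i + 1 + k - 1) % k, hlt (i + 1)⟩ := by
    intro i
    have : g.graph.Adj (c ⟨(i + k - 1) % k, hlt i⟩) (c ⟨(i + 1 + k - 1) % k, hlt (i + 1)⟩) := by
      refine hadj _ _ ?_
      simp only [Nat.mod_add_mod]
      congr 1
      omega
    obtain ⟨e, he, hee⟩ := List.getElem_of_mem ((g.mem_edges _ _).2 this)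
    have he' := getD_flatMap_pair (fun e => (e.1 : ℕ)) (fun e => (e.2 : ℕ)) g.edges e he
    rw [hee] at he'
    exact ⟨e, he, he'⟩
  -- The index is shifted by one so that `w (i + 1)` is the vertex `c i`, matching the position at
  -- which `Walk` tests it; then `w 0` and `w k` both come from `c (k - 1)`.
  set w : ℕ → ℕ := fun i => id (c ⟨(i + k - 1) % k, hlt i⟩) with hwdef
  have hwlt : ∀ i, w i < 2 * g.edges.length + 1 := by
    intro i
    obtain ⟨e, he, h1, -⟩ := hedge i
    have := hid.lt (2 * e) (by omega)
    rw [h1] at this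
    exact this.trans (Nat.lt_succ_self _)
  have hsucc : ∀ i (hi : i < k), w (i + 1) = id (c ⟨i, hi⟩) := by
    intro i hi
    simp only [hwdef]
    congr 3
    apply Fin.ext
    simp only
    rw [Nat.add_right_comm, Nat.add_sub_cancel, Nat.add_mod_right, Nat.mod_eq_of_lt hi]
  obtain ⟨h, hh, hb⟩ := exists_colour (k := k) (fun i => w (i + 1)) (fun i _ => hwlt (i + 1)) (by
    intro i hi j hj hij heq
    obtain ⟨e, he, -, h1⟩ := hedge i
    obtain ⟨e', he', -, h1'⟩ := hedge j
    have h2 := hid.inv (2 * e + 1) (by omega)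
    have h2' := hid.inv (2 * e' + 1) (by omega)
    rw [h1] at h2
    rw [h1'] at h2'
    change (endpoints g).getD (w (i + 1)) 0 = _ at h2
    change (endpoints g).getD (w (j + 1)) 0 = _ at h2'
    rw [heq, h2'] at h2
    have := congrArg Fin.val (hinj (Fin.ext h2))
    simp only at this
    rw [Nat.add_right_comm, Nat.add_sub_cancel, Nat.add_mod_right, Nat.mod_eq_of_lt hj,
      Nat.add_right_comm, Nat.add_sub_cancel, Nat.add_mod_right, Nat.mod_eq_of_lt hi] at this
    exact hij this.symm)
  refine ⟨h, hh, w, ⟨hwlt 0, fun i hi => ?_⟩, ?_⟩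
  · obtain ⟨e, he, h1, h2⟩ := hedge i
    refine ⟨e, he, ?_, ?_, hb i hi⟩
    · change id ((endpoints g).getD (2 * e) 0) = _
      rw [h1]
    · change id ((endpoints g).getD (2 * e + 1) 0) = _
      rw [h2]
  · simp only [hwdef]
    congr 3
    apply Fin.ext
    simp only
    have : k + k - 1 = 0 + k - 1 + k := by omega
    rw [this, Nat.add_mod_right]

end

/-! ### The instance -/

namespace Params

variable (x : Params) (γ : ℚ)

def vassSize : ℕ := stateCount x.k x.q x.m + transCount x.k x.m

theorem stateCount_pos : 0 < stateCount x.k x.q x.m := by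
  have := layer_gt_one x.k_pos x.m
  rw [stateCount]
  positivity

instance : NeZero (stateCount x.k x.q x.m) := ⟨Nat.ne_of_gt x.stateCount_pos⟩

/-- A transition, given by numbers, as a transition of the VASS. -/
def toTrans (t : ℕ × ℕ × ℕ) :
    Fin (stateCount x.k x.q x.m) × (Fin 1 → ℤ) × Fin (stateCount x.k x.q x.m) :=
  (Fin.ofNat _ t.1, fun _ => (t.2.1 : ℤ) - 1, Fin.ofNat _ t.2.2)

def transList : List (Fin (stateCount x.k x.q x.m) × (Fin 1 → ℤ) × Fin (stateCount x.k x.q x.m)) :=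
  x.triples.map x.toTrans

theorem toTrans_inj {t t' : ℕ × ℕ × ℕ} (ht : t ∈ x.triples) (ht' : t' ∈ x.triples)
    (h : x.toTrans t = x.toTrans t') : t = t' := by
  obtain ⟨h1, h2, h3⟩ := x.triples_lt ht
  obtain ⟨h1', h2', h3'⟩ := x.triples_lt ht'
  simp only [toTrans, Prod.mk.injEq] at h
  obtain ⟨e1, e2, e3⟩ := h
  have e1 := congrArg Fin.val e1
  have e2 := congrFun e2 0
  have e3 := congrArg Fin.val e3
  simp only [Fin.val_ofNat, Nat.mod_eq_of_lt h1, Nat.mod_eq_of_lt h1', Nat.mod_eq_of_lt h3,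
    Nat.mod_eq_of_lt h3'] at e1 e3
  refine Prod.ext e1 (Prod.ext ?_ e3)
  omega

theorem nodup_transList : x.transList.Nodup :=
  List.Nodup.map_on (fun _ h _ h' e => x.toTrans_inj h h' e) x.nodup_triples

theorem length_transList : x.transList.length = transCount x.k x.m := by
  rw [transList, List.length_map, length_triples]

def vass : UnaryVASS 1 (Fin (stateCount x.k x.q x.m)) where
  trans := x.transList.toFinset
  nonempty := by
    have hG := layer_gt_one x.k_pos x.m
    -- The chain is non-trivial even for a graph without edges, since there are at least two
    -- colours.
    have : (0, 0, 1) ∈ x.triples := (x.mem_triples _).2 (Or.inl ⟨0, hG, rfl⟩)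
    exact ⟨_, List.mem_toFinset.2 (List.mem_map_of_mem this)⟩
  unary t ht i := by
    obtain ⟨t', ht', rfl⟩ := List.mem_map.1 (List.mem_toFinset.1 ht)
    obtain ⟨-, h, -⟩ := x.triples_lt ht'
    simp only [toTrans]
    omega

theorem size_vass : x.vass.size = x.vassSize := by
  rw [UnaryVASS.size, Fintype.card_fin, vass, List.toFinset_card_of_nodup x.nodup_transList,
    length_transList, vassSize]

/-- The counter bound for the instance. -/
def bound : ℕ := linearBound γ x.vassSize

theorem last_lt : x.k * layer x.k x.m < stateCount x.k x.q x.m := by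
  have := layer_gt_one x.k_pos x.m
  rw [stateCount]
  exact Nat.mul_lt_mul_of_pos_right (by omega) (by omega)

/-- Both counter values are the bound itself, which makes coverability coincide with reachability.
-/
def inst : BoundedVASSInput (linearBound γ) 1 where
  numStates := stateCount x.k x.q x.m
  vass := x.vass
  source := (Fin.ofNat _ 0, fun _ => x.bound γ)
  target := (Fin.ofNat _ (x.k * layer x.k x.m), fun _ => x.bound γ)
  source_le _ := by rw [size_vass, bound]
  target_le _ := by rw [size_vass, bound]
  transList := x.transList
  nodup := x.nodup_transList
  mem_transList t := by rw [vass, List.mem_toFinset]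

/-- The encoding of the instance. -/
def words : List ℕ :=
  [stateCount x.k x.q x.m, transCount x.k x.m, 0, x.bound γ, x.k * layer x.k x.m, x.bound γ] ++
    x.triples.flatMap fun t => [t.1, t.2.1, t.2.2]

theorem encode_inst : (x.inst γ).encode = x.words γ := by
  have h : ∀ l : List (ℕ × ℕ × ℕ), (∀ t ∈ l, t ∈ x.triples) →
      ((l.map x.toTrans).flatMap fun t =>
        (t.1 : ℕ) :: (List.ofFn (fun i => (t.2.1 i + 1).toNat) ++ [(t.2.2 : ℕ)])) =
      l.flatMap fun t => [t.1, t.2.1, t.2.2] := by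
    intro l
    induction l with
    | nil => exact fun _ => rfl
    | cons t l ih =>
      intro hl
      obtain ⟨h1, h2, h3⟩ := x.triples_lt (hl t (List.mem_cons_self ..))
      rw [List.map_cons, List.flatMap_cons, List.flatMap_cons,
        ih fun t ht => hl t (List.mem_cons_of_mem _ ht)]
      simp [toTrans, Nat.mod_eq_of_lt h1, Nat.mod_eq_of_lt h3]
  rw [BoundedVASSInput.encode, words]
  simp only [inst]
  rw [length_transList, transList, h _ fun _ ht => ht]
  simp [Nat.mod_eq_of_lt x.last_lt]

theorem exists_step_of_BStep {B : ℕ} {c c' : Fin (stateCount x.k x.q x.m) × (Fin 1 → ℕ)}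
    (h : x.vass.BStep B c c') : x.Step B (c.1, c.2 0) (c'.1, c'.2 0) := by
  obtain ⟨h1, h2, u, hu, he⟩ := h
  obtain ⟨t, ht, hte⟩ := List.mem_map.1 (List.mem_toFinset.1 hu)
  obtain ⟨l1, -, l3⟩ := x.triples_lt ht
  simp only [toTrans, Prod.mk.injEq] at hte
  obtain ⟨e1, rfl, e3⟩ := hte
  have e1 := congrArg Fin.val e1
  have e3 := congrArg Fin.val e3
  simp only [Fin.val_ofNat, Nat.mod_eq_of_lt l1, Nat.mod_eq_of_lt l3] at e1 e3
  refine ⟨t.2.1, ?_, ?_, h1 0, h2 0⟩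
  · simp only
    rw [← e1, ← e3]
    exact ht
  · have := he 0
    simp only at this ⊢
    omega

theorem BStep_of_step {B : ℕ} {c c' : ℕ × ℕ} (h : x.Step B c c') :
    x.vass.BStep B (Fin.ofNat _ c.1, fun _ => c.2) (Fin.ofNat _ c'.1, fun _ => c'.2) := by
  obtain ⟨b, hb, he, h1, h2⟩ := h
  refine ⟨fun _ => h1, fun _ => h2, _, List.mem_toFinset.2 (List.mem_map_of_mem hb), fun _ => ?_⟩
  simp only
  omega

/-- The padding gives `n ≥ γ.den * layer`, so `γ * n ≥ γ.num * layer ≥ layer`. -/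
theorem le_bound (hγ : 0 < γ) (hq : x.q = γ.den) : layer x.k x.m ≤ x.bound γ := by
  have h : γ.den * layer x.k x.m ≤ x.vassSize := by
    rw [vassSize, stateCount, hq]
    exact (Nat.mul_le_mul_right _ (by omega)).trans (Nat.le_add_right _ _)
  rw [bound, linearBound, Nat.le_floor_iff (by positivity)]
  have h' : (γ.den : ℚ) * (layer x.k x.m : ℚ) ≤ (x.vassSize : ℚ) := by exact_mod_cast h
  have hnum : (1 : ℚ) ≤ γ.num := by exact_mod_cast Rat.num_pos.2 hγ
  calc (layer x.k x.m : ℚ) ≤ γ.num * layer x.k x.m := le_mul_of_one_le_left (by positivity) hnum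
    _ = γ * (γ.den * layer x.k x.m) := by rw [← mul_assoc, Rat.mul_den_eq_num]
    _ ≤ γ * x.vassSize := mul_le_mul_of_nonneg_left h' hγ.le

/-- The form in which the program computes the bound, with integer operations only. -/
theorem bound_eq (hγ : 0 < γ) : x.bound γ = γ.num.toNat * x.vassSize / γ.den := by
  rw [bound, linearBound]
  have hn : ((γ.num.toNat : ℕ) : ℚ) = γ.num := by
    exact_mod_cast Int.toNat_of_nonneg (Rat.num_pos.2 hγ).le
  have : γ * (x.vassSize : ℚ) = ((γ.num.toNat * x.vassSize : ℕ) : ℚ) / (γ.den : ℚ) := by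
    rw [Nat.cast_mul, hn, mul_div_right_comm, Rat.num_div_den]
  rw [this, Nat.floor_div_eq_div]

end Params

variable {g : GraphInput} {id : ℕ → ℕ} (hid : Numbering g id) {k : ℕ} (hk : 0 < k) (q : ℕ)

theorem hasKCycle_of_cover {γ : ℚ} {v : Fin 1 → ℕ}
    (hv : ∀ i, ((params g hid hk q).inst γ).target.2 i ≤ v i)
    (h : ((params g hid hk q).inst γ).vass.BReach
      (linearBound γ ((params g hid hk q).inst γ).vass.size) ((params g hid hk q).inst γ).source
        (((params g hid hk q).inst γ).target.1, v)) : g.graph.HasKCycle k := by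
  set x := params g hid hk q with hx
  have hsize : linearBound γ (x.inst γ).vass.size = x.bound γ := congrArg _ x.size_vass
  rw [hsize] at h
  have hinv : ∀ c, x.vass.BReach (x.bound γ) (Fin.ofNat _ 0, fun _ => x.bound γ) c →
      x.Inv (x.bound γ) (c.1, c.2 0) ∧ c.2 0 ≤ x.bound γ := by
    intro c hc
    induction hc with
    | refl => exact ⟨by simpa using Params.Inv.start x, le_rfl⟩
    | tail _ hs ih => exact ⟨ih.1.step x (x.exists_step_of_BStep hs), hs.2.1 0⟩
  obtain ⟨h1, h2⟩ := hinv _ h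
  have e : ((x.inst γ).target.1 : ℕ) = x.k * layer x.k x.m := by
    simp [Params.inst, Nat.mod_eq_of_lt x.last_lt]
  simp only at h1 h2
  change x.Inv _ (((x.inst γ).target.1 : ℕ), _) at h1
  rw [e] at h1
  obtain ⟨h, w, hw, hc⟩ := h1.closed_walk x (hv 0) h2
  exact hasKCycle_of_closed_walk hid hk q hw hc

theorem reach_of_hasKCycle {γ : ℚ} (hγ : 0 < γ) (hq : q = γ.den) (hg : g.graph.HasKCycle k) :
    ((params g hid hk q).inst γ).vass.BReach
      (linearBound γ ((params g hid hk q).inst γ).vass.size) ((params g hid hk q).inst γ).source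
        ((params g hid hk q).inst γ).target := by
  set x := params g hid hk q with hx
  have hsize : linearBound γ (x.inst γ).vass.size = x.bound γ := congrArg _ x.size_vass
  rw [hsize]
  obtain ⟨h, hh, w, hw, hc⟩ := exists_closed_walk hid hk q hg
  have := x.reach_of_closed_walk (x.le_bound γ hγ hq) hh hw hc
  exact this.lift (fun c => (Fin.ofNat _ c.1, fun _ => c.2)) fun _ _ h => x.BStep_of_step h

set_option linter.unusedSimpArgs false

/-! ### The program that writes the instance -/

/-- Memory with `f` below address `o` and the list `l` from there on. -/
def layout (f : ℕ → ℕ) (o : ℕ) (l : List ℕ) (a : ℕ) : ℕ := if a < o then f a else l.getD (a - o) 0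

theorem update_layout (f : ℕ → ℕ) (o : ℕ) (l : List ℕ) (v : ℕ) :
    Function.update (layout f o l) (o + l.length) v = layout f o (l ++ [v]) := by
  funext a
  by_cases h : a = o + l.length
  · subst h
    simp [layout]
  · rw [Function.update_of_ne h, layout, layout]
    split
    · rfl
    · by_cases h' : a - o < l.length
      · rw [List.getD_append _ _ _ _ h']
      · rw [List.getD_eq_default _ _ (by omega), List.getD_eq_default _ _ (by simp; omega)]

/-- Append the contents of three registers to the list that ends at address `R[7]`. -/
def emit (a b c : ℕ) : List Instr :=
  [.store 7 a, .binop .add 7 7 0, .store 7 b, .binop .add 7 7 0, .store 7 c, .binop .add 7 7 0]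

theorem wp_emit {w a b c o : ℕ} {l : List ℕ} {f r : ℕ → ℕ} {rest : List Instr}
    {Q : (ℕ → ℕ) → (ℕ → ℕ) → Prop} (hb : b ≠ 7) (hc : c ≠ 7)
    (h0 : r 0 = 1) (h7 : r 7 = o + l.length) (hw : o + l.length + 3 < 2 ^ w)
    (h : wp w rest Q (Function.update r 7 (o + l.length + 3))
      (layout f o (l ++ [r a, r b, r c]))) :
    wp w (emit a b c ++ rest) Q r (layout f o l) := by
  have e1 := update_layout f o l (r a)
  have e2 := update_layout f o (l ++ [r a]) (r b)
  have e3 := update_layout f o (l ++ [r a] ++ [r b]) (r c)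
  simp only [List.length_append, List.length_cons, List.length_nil, ← Nat.add_assoc,
    Nat.zero_add] at e1 e2 e3
  simp only [emit, List.cons_append, List.nil_append, wp, BinOp.eval, Function.update_self,
    Function.update_of_ne hb, Function.update_of_ne hc,
    Function.update_idem, h0, h7, e1, e2, e3, Function.update_of_ne (show (0 : ℕ) ≠ 7 by decide)]
  refine ⟨by omega, by omega, by omega, ?_⟩
  simpa using h

/-! ### Counting violations and numbering the vertices -/

theorem violation_le (k j v d p : ℕ) : violation k j v d p ≤ 1 := by
  have hx := bitTest_lt_two d v
  have h1 : 1 - (j ^^^ (p / k)) ≤ 1 := Nat.sub_le _ _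
  have h2 : 1 - (j ^^^ (p % k)) ≤ 1 := Nat.sub_le _ _
  rw [violation]
  generalize 1 - (j ^^^ (p / k)) = a at *
  generalize 1 - (j ^^^ (p % k)) = b at *
  generalize bitTest d v = c at *
  interval_cases a <;> interval_cases b <;> interval_cases c <;> simp

theorem badness_le (k D j v K h : ℕ) : badness k D j v K h ≤ K := by
  induction K generalizing h with
  | zero => exact le_rfl
  | succ K ih =>
    rw [badness]
    have := ih (h / D)
    have := violation_le k j v (h % D) K
    omega

/-- One round of the loop that adds up the violations. -/
def testBody : List Instr :=
  [.binop .sub 22 22 0, .binop .div 24 22 8, .binop .mod 25 22 8, .binop .mod 26 18 9,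
    .binop .div 18 18 9, .binop .div 27 26 1, .binop .shr 27 21 27, .binop .add 27 27 26,
    .binop .mod 27 27 1, .binop .xor 24 19 24, .binop .sub 24 0 24, .binop .xor 25 19 25,
    .binop .sub 25 0 25, .binop .sub 25 25 24, .binop .mul 24 24 27, .binop .sub 27 0 27,
    .binop .mul 25 25 27, .binop .add 23 23 24, .binop .add 23 23 25]

/-- Loop invariant: the violations counted so far, plus those still to be found with the remaining
digits in register `18`, make up the total. As the total is at most `K`, the count never overflows.
-/
theorem ex_test {w k D j v h K : ℕ} {r m : ℕ → ℕ} (h0 : r 0 = 1) (h1 : r 1 = 2) (h8 : r 8 = k)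
    (h9 : r 9 = D) (h19 : r 19 = j) (h21 : r 21 = v) (h22 : r 22 = K) (h23 : r 23 = 0)
    (h18 : r 18 = h) (hD : 0 < D) (hjw : j < 2 ^ w) (hvw : v + D < 2 ^ w) (hhw : h < 2 ^ w)
    (hKw : K < 2 ^ w) :
    Ex w (.loop 22 (.block testBody)) (K * 21 + 1) r m
      fun r' m' => m' = m ∧ r' 23 = badness k D j v K h := by
  refine Ex.mono (Ex.loop (t := 19) (n := K) (fun p r' m' => m' = m ∧ r' 22 = p ∧ r' 18 ≤ h ∧
    r' 23 + badness k D j v p (r' 18) = badness k D j v K h) ?_ ?_ ?_) le_rfl ?_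
  · exact ⟨rfl, h22, h18.le, by rw [h23, h18, Nat.zero_add]⟩
  · exact fun r' m' h => h.2.1
  · rintro p r' m' hp ⟨rfl, g22, g18, g23⟩ hf
    refine ⟨by omega, ?_⟩
    have g0 := (hf 0 (by decide)).trans h0
    have g1 := (hf 1 (by decide)).trans h1
    have g8 := (hf 8 (by decide)).trans h8
    have g9 := (hf 9 (by decide)).trans h9
    have g19 := (hf 19 (by decide)).trans h19
    have g21 := (hf 21 (by decide)).trans h21
    refine Ex.block (l := testBody) ?_
    simp only [testBody, wp, BinOp.eval, Function.update_apply, reduceIte, Nat.reduceEqDiff,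
      OfNat.ofNat_ne_zero, OfNat.ofNat_ne_one, OfNat.zero_ne_ofNat, OfNat.one_ne_ofNat,
          one_ne_zero, zero_ne_one, g0, g1, g8, g9, g19, g21, g22, Nat.add_sub_cancel]
    rw [badness, violation, bitTest] at g23
    have hle := badness_le k D j v K h
    have hd : r' 18 % D < D := Nat.mod_lt _ hD
    have hq : r' 18 / D ≤ r' 18 := Nat.div_le_self _ _
    have hs : v >>> (r' 18 % D / 2) ≤ v := by
      rw [Nat.shiftRight_eq_div_pow]
      exact Nat.div_le_self _ _
    have hp1 : p / k ≤ p := Nat.div_le_self _ _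
    have hp2 : p % k ≤ p := Nat.mod_le _ _
    have hx1 : j ^^^ p / k < 2 ^ w := Nat.xor_lt_two_pow hjw (by omega)
    have hx2 : j ^^^ p % k < 2 ^ w := Nat.xor_lt_two_pow hjw (by omega)
    refine ⟨by omega, by omega, by omega, by omega, by omega, by omega, by omega, by omega,
      by omega, hx1, by omega, hx2, by omega, by omega, by omega, by omega, by omega, by omega,
      by omega, trivial, trivial, by omega, by omega⟩
  · exact fun r' m' _ ⟨h1, h2, h3, h4⟩ => ⟨h1, by simpa [badness] using h4⟩

/-- The vertices on edges get numbers: the last place in the input where they occur. -/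
def idBody : List Instr :=
  [.binop .sub 28 28 0, .binop .add 24 28 1, .load 24 24, .binop .add 24 24 5, .store 24 28]

theorem endpoints_lt (g : GraphInput) {i : ℕ} (hi : i < 2 * g.edges.length) :
    (endpoints g).getD i 0 < g.numVertices := by
  rw [← length_endpoints] at hi
  rw [List.getD_eq_getElem _ _ hi]
  have := List.getElem_mem hi
  simp only [endpoints, List.mem_flatMap, List.mem_cons, List.not_mem_nil, or_false] at this
  obtain ⟨e, -, h | h⟩ := this
  · exact h.trans_lt e.1.2
  · exact h.trans_lt e.2.2

theorem encode_getD (g : GraphInput) (i : ℕ) :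
    g.encode.getD (i + 2) 0 = (endpoints g).getD i 0 := rfl

/-- The low memory `f` holds the edges and the numbers `id v` of the vertices. -/
structure Tables (g : GraphInput) (id f : ℕ → ℕ) : Prop where
  edges : ∀ i < 2 * g.edges.length, f (i + 2) = (endpoints g).getD i 0
  ids : ∀ i < 2 * g.edges.length, f ((endpoints g).getD i 0 + (2 * g.edges.length + 2)) =
    id ((endpoints g).getD i 0)

/-- The table has an entry for every vertex but is only touched at vertices lying on edges. The
running time therefore depends on the number of edges and not on the number of vertices. -/
theorem ex_ids (g : GraphInput) {w : ℕ} {r : ℕ → ℕ} (h0 : r 0 = 1) (h1 : r 1 = 2)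
    (h5 : r 5 = 2 * g.edges.length + 2) (h28 : r 28 = 2 * g.edges.length)
    (hw : 2 * g.edges.length + 2 + g.numVertices < 2 ^ w) :
    Ex w (.loop 28 (.block idBody)) (2 * g.edges.length * 7 + 1) r
      (fun a => g.encode.getD a 0) fun _ m => ∃ id f, Numbering g id ∧ Tables g id f ∧
        m = layout f (2 * g.edges.length + 2 + g.numVertices) [] := by
  set M := g.edges.length with hM
  set A := fun i => (endpoints g).getD i 0 with hA
  have hAlt : ∀ i < 2 * M, A i < g.numVertices := fun i hi => endpoints_lt g hi
  -- Invariant: the endpoint list is intact, memory behind the table is still zero, and the entry of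
  -- each endpoint listed from place `c` on is some place where that vertex occurs. Overwriting an
  -- entry preserves this.
  refine Ex.mono (Ex.loop (t := 5) (n := 2 * M) (fun c r' m' => r' 28 = c ∧
    (∀ i < 2 * M, m' (i + 2) = A i) ∧ (∀ a, 2 * M + 2 + g.numVertices ≤ a → m' a = 0) ∧
    ∀ i < 2 * M, c ≤ i → m' (A i + (2 * M + 2)) < 2 * M ∧ A (m' (A i + (2 * M + 2))) = A i)
      ?_ ?_ ?_) le_rfl ?_
  · refine ⟨h28, fun i _ => encode_getD g i, fun a ha => ?_, fun i hi hi' => by omega⟩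
    obtain ⟨b, rfl⟩ : ∃ b, a = b + 2 := ⟨a - 2, by omega⟩
    rw [encode_getD]
    exact List.getD_eq_default _ _ (by rw [length_endpoints]; omega)
  · exact fun r' m' h => h.1
  · rintro c r' m' hc ⟨g28, gA, gz, gid⟩ hf
    refine ⟨by omega, ?_⟩
    have g0 := (hf 0 (by decide)).trans h0
    have g1 := (hf 1 (by decide)).trans h1
    have g5 := (hf 5 (by decide)).trans h5
    refine Ex.block (l := idBody) ?_
    have hlt := hAlt c hc
    simp only [idBody, wp, BinOp.eval, Function.update_apply, reduceIte, Nat.reduceEqDiff,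
      OfNat.ofNat_ne_zero, OfNat.ofNat_ne_one, OfNat.zero_ne_ofNat, OfNat.one_ne_ofNat,
      one_ne_zero, zero_ne_one,
      g0, g1, g5, g28, Nat.add_sub_cancel, gA c hc]
    refine ⟨by omega, by omega, by omega, by omega, trivial, fun i hi => ?_, fun a ha => ?_,
      fun i hi hci => ?_⟩
    · rw [if_neg (by omega), gA i hi]
    · rw [if_neg (by omega), gz a ha]
    · by_cases hic : A i = A c
      · rw [if_pos (by omega)]
        exact ⟨hc, hic.symm⟩
      · rw [if_neg (by omega)]
        have : i ≠ c := fun h => hic (by rw [h])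
        exact gid i hi (by omega)
  · rintro r' m' - ⟨-, gA, gz, gid⟩
    refine ⟨fun v => m' (v + (2 * M + 2)), m', ⟨fun i hi => (gid i hi (Nat.zero_le _)).1,
      fun i hi => (gid i hi (Nat.zero_le _)).2⟩, ⟨gA, fun i _ => rfl⟩, ?_⟩
    funext a
    rw [layout]
    split
    · rfl
    · rw [gz a (by omega)]
      rfl

/-! ### Computing the numbers of tests and colours -/

theorem size_shiftRight_one {a n : ℕ} (h : a.size = n + 1) : (a >>> 1).size = n := by
  rw [Nat.shiftRight_eq_div_pow, pow_one]
  apply le_antisymm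
  · rw [Nat.size_le]
    have : a < 2 ^ (n + 1) := Nat.size_le.1 h.le
    rw [pow_succ] at this
    omega
  · rcases Nat.eq_zero_or_pos n with rfl | hn
    · exact Nat.zero_le _
    · obtain ⟨n, rfl⟩ : ∃ n', n = n' + 1 := ⟨n - 1, by omega⟩
      have : 2 ^ (n + 1) ≤ a := Nat.lt_size.1 (by omega)
      rw [pow_succ] at this
      exact Nat.lt_size.2 (by omega)

/-- Compute twice the number of bits of `R[27]` in register `9`. -/
def sizeBody : List Instr := [.binop .shr 27 27 0, .binop .add 9 9 1]

theorem ex_size {w R : ℕ} {r m : ℕ → ℕ} (h0 : r 0 = 1) (h1 : r 1 = 2) (h9 : r 9 = 0)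
    (h27 : r 27 = R) (hR : R < 2 ^ w) (hw : 2 * R.size < 2 ^ w) :
    Ex w (.loop 27 (.block sizeBody)) (R.size * 4 + 1) r m
      fun r' m' => m' = m ∧ r' 9 = 2 * R.size := by
  refine Ex.mono (Ex.loop (t := 2) (n := R.size) (fun n r' m' => m' = m ∧ (r' 27).size = n ∧
    r' 27 ≤ R ∧ r' 9 + 2 * n = 2 * R.size) ?_ ?_ ?_) le_rfl ?_
  · exact ⟨rfl, by rw [h27], h27.le, by omega⟩
  · exact fun r' m' h => Nat.size_eq_zero.1 h.2.1
  · rintro n r' m' hn ⟨rfl, gs, g27, g9⟩ hf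
    have g0 := (hf 0 (by decide)).trans h0
    have g1 := (hf 1 (by decide)).trans h1
    refine ⟨fun h => ?_, Ex.block (l := sizeBody) ?_⟩
    · rw [h, Nat.size_zero] at gs
      omega
    · have hle : r' 27 >>> 1 ≤ r' 27 := by
        rw [Nat.shiftRight_eq_div_pow]
        exact Nat.div_le_self _ _
      simp only [sizeBody, wp, BinOp.eval, Function.update_apply, reduceIte, Nat.reduceEqDiff,
      OfNat.ofNat_ne_zero, OfNat.ofNat_ne_one, OfNat.zero_ne_ofNat, OfNat.one_ne_ofNat,
      one_ne_zero, zero_ne_one, g0, g1]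
      exact ⟨by omega, by omega, trivial, size_shiftRight_one gs, by omega, by omega⟩
  · exact fun r' m' _ ⟨h1, _, _, h4⟩ => ⟨h1, by omega⟩

/-- Multiply register `10` by register `9`. -/
def powBody : List Instr := [.binop .sub 28 28 0, .binop .mul 10 10 9]

/-- Register `10` times the power still missing is constantly `D ^ K`, so all intermediate products
fit into a word as soon as the result does. -/
theorem ex_pow {w D K : ℕ} {r m : ℕ → ℕ} (h0 : r 0 = 1) (h9 : r 9 = D) (h10 : r 10 = 1)
    (h28 : r 28 = K) (hD : 0 < D) (hK : K < 2 ^ w) (hw : D ^ K < 2 ^ w) :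
    Ex w (.loop 28 (.block powBody)) (K * 4 + 1) r m
      fun r' m' => m' = m ∧ r' 10 = D ^ K := by
  refine Ex.mono (Ex.loop (t := 2) (n := K) (fun n r' m' => m' = m ∧ r' 28 = n ∧
    r' 10 * D ^ n = D ^ K) ?_ ?_ ?_) le_rfl ?_
  · exact ⟨rfl, h28, by rw [h10, Nat.one_mul]⟩
  · exact fun r' m' h => h.2.1
  · rintro n r' m' hn ⟨rfl, g28, g10⟩ hf
    have g0 := (hf 0 (by decide)).trans h0
    have g9 := (hf 9 (by decide)).trans h9
    refine ⟨by omega, Ex.block (l := powBody) ?_⟩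
    have hm : r' 10 * D * D ^ n = D ^ K := by rw [← g10, pow_succ']; ring
    have hle : r' 10 * D ≤ D ^ K := by
      rw [← hm]
      exact Nat.le_mul_of_pos_right _ (Nat.pow_pos hD)
    simp only [powBody, wp, BinOp.eval, Function.update_apply, reduceIte, Nat.reduceEqDiff,
      OfNat.ofNat_ne_zero, OfNat.ofNat_ne_one, OfNat.zero_ne_ofNat, OfNat.one_ne_ofNat,
      one_ne_zero, zero_ne_one, g0, g9, g28, Nat.add_sub_cancel]
    exact ⟨by omega, by omega, trivial, trivial, hm⟩
  · rintro r' m' - ⟨h1, -, h3⟩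
    exact ⟨h1, by simpa using h3⟩

/-- A list of transitions as a list of words. -/
def flat (l : List (ℕ × ℕ × ℕ)) : List ℕ := l.flatMap fun t => [t.1, t.2.1, t.2.2]

theorem length_flat (l : List (ℕ × ℕ × ℕ)) : (flat l).length = 3 * l.length := by
  simp [flat, Nat.mul_comm]

theorem flat_append (l l' : List (ℕ × ℕ × ℕ)) : flat (l ++ l') = flat l ++ flat l' :=
  List.flatMap_append

/-! ### Writing the transitions -/

namespace Params

variable (x : Params)

/-- The registers that keep their values while the transitions are written. -/
structure Regs (r : ℕ → ℕ) : Prop where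
  one : r 0 = 1
  two : r 1 = 2
  edges : r 2 = x.m
  ids : r 4 = 2 * x.m + 1
  table : r 5 = 2 * x.m + 2
  len : r 8 = x.k
  tests : r 9 = numTests x.m
  colours : r 10 = numColours x.k x.m
  last : r 13 = x.k * layer x.k x.m
  dead : r 14 = (x.k + 1) * layer x.k x.m
  zero : r 39 = 0

variable {x} in
theorem Regs.frame {r r' : ℕ → ℕ} (h : x.Regs r)
    (hr : ∀ d ∈ [0, 1, 2, 4, 5, 8, 9, 10, 13, 14, 39], r' d = r d) : x.Regs r' := by
  obtain ⟨h0, h1, h2, h3, h4, h5, h6, h7, h8, h9, h10⟩ := h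
  simp only [List.forall_mem_cons] at hr
  obtain ⟨e0, e1, e2, e3, e4, e5, e6, e7, e8, e9, e10, -⟩ := hr
  exact ⟨e0.trans h0, e1.trans h1, e2.trans h2, e3.trans h3, e4.trans h4, e5.trans h5,
    e6.trans h6, e7.trans h7, e8.trans h8, e9.trans h9, e10.trans h10⟩

/-- Comparisons between the non-linear quantities, which `omega` then treats as atoms when it checks
that values fit into words. -/
theorem sizes : 1 < layer x.k x.m ∧ 2 * x.m + 1 ≤ layer x.k x.m ∧
    numColours x.k x.m ≤ layer x.k x.m ∧ numTests x.m ≤ numColours x.k x.m ∧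
    x.k * x.k < numColours x.k x.m ∧ layer x.k x.m ≤ x.k * layer x.k x.m ∧
    x.k ≤ x.k * layer x.k x.m ∧ x.q ≤ x.q * layer x.k x.m ∧
    stateCount x.k x.q x.m =
      2 * (x.k * layer x.k x.m) + 2 * layer x.k x.m + x.q * layer x.k x.m := by
  have hG := layer_gt_one x.k_pos x.m
  have hF := numColours_gt_one x.k_pos x.m
  have hD := numTests_pos x.m
  refine ⟨hG, Nat.le_mul_of_pos_left _ (by omega), Nat.le_mul_of_pos_right _ (by omega), ?_, ?_,
    Nat.le_mul_of_pos_left _ x.k_pos, Nat.le_mul_of_pos_right _ (by omega),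
    Nat.le_mul_of_pos_right _ (by omega), ?_⟩
  · exact Nat.le_self_pow (Nat.mul_pos x.k_pos x.k_pos).ne' _
  · exact Nat.lt_pow_self hD
  · rw [stateCount]
    ring

/-- The list of words with `l` in memory at address `o` and `rest` still to be written. -/
def Writing (f : ℕ → ℕ) (o : ℕ) (total rest : List ℕ) (r m : ℕ → ℕ) : Prop :=
  ∃ l, m = layout f o l ∧ r 7 = o + l.length ∧ l ++ rest = total

/-- Write the counting transitions for the state `R[28] - 1`. -/
def chainBody : List Instr :=
  [.binop .sub 26 28 0, .binop .add 24 13 28, .binop .add 25 13 26] ++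
    (emit 26 39 28 ++ (emit 24 1 25 ++ [.binop .add 28 26 39]))

theorem ex_chain {w o : ℕ} {f r m : ℕ → ℕ} {total rest : List ℕ} (hr : x.Regs r)
    (h28 : r 28 = layer x.k x.m - 1)
    (hwr : Writing f o total (flat ((List.range (layer x.k x.m - 1)).reverse.flatMap x.chain) ++
      rest) r m) (hw : o + total.length < 2 ^ w) (hS : stateCount x.k x.q x.m < 2 ^ w) :
    Ex w (.loop 28 (.block chainBody)) ((layer x.k x.m - 1) * 18 + 1) r m
      (Writing f o total rest) := by
  obtain ⟨hG, -, -, -, -, hkG, -, -, hSe⟩ := x.sizes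
  refine Ex.mono (Ex.loop (t := 16) (n := layer x.k x.m - 1) (fun c r' m' => r' 28 = c ∧
    Writing f o total (flat ((List.range c).reverse.flatMap x.chain) ++ rest) r' m')
      ?_ ?_ ?_) le_rfl ?_
  · exact ⟨h28, hwr⟩
  · exact fun r' m' h => h.1
  · rintro c r' m' hc ⟨g28, l, rfl, g7, hl⟩ hf
    refine ⟨by omega, Ex.block (l := chainBody) ?_⟩
    have hr' := hr.frame fun d hd => hf d (by revert d; decide)
    rw [List.range_succ, List.reverse_append, List.reverse_singleton, List.singleton_append,
      List.flatMap_cons, flat_append] at hl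
    have hlen := congrArg List.length hl
    simp only [List.length_append, length_flat, chain, List.length_cons, List.length_nil] at hlen
    rw [chainBody]
    simp only [List.cons_append, List.nil_append, wp, BinOp.eval]
    refine ⟨?_, ?_, ?_, ?_⟩
    · rw [g28, hr'.one]
      omega
    · simp only [wp, BinOp.eval, Function.update_apply, reduceIte, Nat.reduceEqDiff,
      OfNat.ofNat_ne_zero, OfNat.ofNat_ne_one, OfNat.zero_ne_ofNat, OfNat.one_ne_ofNat,
      one_ne_zero, zero_ne_one,
        g28, hr'.last]
      omega
    · simp only [wp, BinOp.eval, Function.update_apply, reduceIte, Nat.reduceEqDiff,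
      OfNat.ofNat_ne_zero, OfNat.ofNat_ne_one, OfNat.zero_ne_ofNat, OfNat.one_ne_ofNat,
      one_ne_zero, zero_ne_one,
        g28, hr'.one, hr'.last]
      omega
    · refine wp_emit (by decide) (by decide) ?_ ?_ (by omega) ?_
      · simp only [wp, BinOp.eval, Function.update_apply, reduceIte, Nat.reduceEqDiff,
      OfNat.ofNat_ne_zero, OfNat.ofNat_ne_one, OfNat.zero_ne_ofNat, OfNat.one_ne_ofNat,
      one_ne_zero, zero_ne_one, hr'.one]
      · simp only [wp, BinOp.eval, Function.update_apply, reduceIte, Nat.reduceEqDiff,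
      OfNat.ofNat_ne_zero, OfNat.ofNat_ne_one, OfNat.zero_ne_ofNat, OfNat.one_ne_ofNat,
      one_ne_zero, zero_ne_one, g7]
      · refine wp_emit (by decide) (by decide) ?_ ?_ ?_ ?_
        · simp only [wp, BinOp.eval, Function.update_apply, reduceIte, Nat.reduceEqDiff,
      OfNat.ofNat_ne_zero, OfNat.ofNat_ne_one, OfNat.zero_ne_ofNat, OfNat.one_ne_ofNat,
      one_ne_zero, zero_ne_one, hr'.one]
        · simp only [wp, BinOp.eval, Function.update_apply, reduceIte, Nat.reduceEqDiff,
      OfNat.ofNat_ne_zero, OfNat.ofNat_ne_one, OfNat.zero_ne_ofNat, OfNat.one_ne_ofNat,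
      one_ne_zero, zero_ne_one, List.length_append, List.length_cons, List.length_nil,
            Nat.add_assoc]
        · simp only [List.length_append, List.length_cons, List.length_nil]
          omega
        · simp only [wp, BinOp.eval, Function.update_apply, reduceIte, Nat.reduceEqDiff,
      OfNat.ofNat_ne_zero, OfNat.ofNat_ne_one, OfNat.zero_ne_ofNat, OfNat.one_ne_ofNat,
      one_ne_zero, zero_ne_one, g28, hr'.one,
            hr'.zero, hr'.two, hr'.last, Nat.add_sub_cancel]
          refine ⟨by omega, by omega, _, rfl, ?_, ?_⟩
          · simp only [wp, BinOp.eval, Function.update_apply, reduceIte, Nat.reduceEqDiff,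
      OfNat.ofNat_ne_zero, OfNat.ofNat_ne_one, OfNat.zero_ne_ofNat, OfNat.one_ne_ofNat,
      one_ne_zero, zero_ne_one, List.length_append, List.length_cons, List.length_nil,
              Nat.add_assoc]
          · rw [← hl]
            simp [flat, chain]
  · rintro r' m' - ⟨-, h⟩
    simpa [flat] using h

end Params

theorem layout_of_lt (f : ℕ → ℕ) {o a : ℕ} (l : List ℕ) (h : a < o) : layout f o l a = f a :=
  if_pos h

namespace Params

/-- Look up the edge, the layer and the colour given by `R[15] - 1`. -/
def edgeHead (K : ℕ) : List Instr :=
  [.binop .sub 15 15 0, .binop .div 16 15 2, .binop .mod 17 15 2, .binop .mod 18 16 10,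
    .binop .div 19 16 10, .binop .add 24 17 17, .binop .add 24 24 1, .load 20 24,
    .binop .add 20 20 5, .load 20 20, .binop .add 24 24 0, .load 21 24, .binop .add 21 21 5,
    .load 21 21, .const 22 K, .const 23 0]

/-- Write the copy of the edge, whose number of violations is in register `23`. -/
def edgeTail : List Instr :=
  [.binop .sub 23 0 23, .binop .sub 23 0 23, .binop .mul 23 23 14, .binop .mul 24 16 4,
    .binop .add 20 24 20, .binop .add 16 16 10, .binop .mul 24 16 4, .binop .add 21 24 21,
    .binop .add 21 21 23] ++ (emit 20 0 21 ++ [])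

def edgeBody (K : ℕ) : Cmd :=
  (Cmd.block (edgeHead K)).seq ((Cmd.loop 22 (.block testBody)).seq (.block edgeTail))

theorem writes_edgeHead (K : ℕ) : (Cmd.block (edgeHead K)).writes =
    [15, 16, 17, 18, 19, 24, 24, 20, 20, 20, 24, 21, 21, 21, 22, 23] := rfl

theorem writes_edgeBody (K : ℕ) : (edgeBody K).writes =
    [15, 16, 17, 18, 19, 24, 24, 20, 20, 20, 24, 21, 21, 21, 22, 23] ++
      ((Cmd.loop 22 (.block testBody)).writes ++ (Cmd.block edgeTail).writes) := rfl

section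

variable {g : GraphInput} {id : ℕ → ℕ} (hid : Numbering g id) {k : ℕ} (hk : 0 < k) (q : ℕ)

theorem ex_edgeHead {w e s t : ℕ} {f r : ℕ → ℕ} {l : List ℕ} (hf : Tables g id f)
    (hr : (params g hid hk q).Regs r) (he : e < g.edges.length)
    (h15 : r 15 = t + 1)
    (ht : t / g.edges.length = s) (ht' : t % g.edges.length = e)
    (hw : 2 * g.edges.length + 2 + g.numVertices < 2 ^ w) (htw : t < 2 ^ w)
    (hS : stateCount k q g.edges.length < 2 ^ w) :
    Ex w (.block (edgeHead (k * k))) 16 r (layout f (2 * g.edges.length + 2 + g.numVertices) l)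
      fun r' m' => m' = layout f (2 * g.edges.length + 2 + g.numVertices) l ∧ r' 15 = t ∧
        r' 16 = s ∧ r' 18 = s % numColours k g.edges.length ∧
        r' 19 = s / numColours k g.edges.length ∧ r' 20 = (params g hid hk q).eu e ∧
        r' 21 = (params g hid hk q).ev e ∧ r' 22 = k * k ∧ r' 23 = 0 := by
  set x := params g hid hk q with hx
  obtain ⟨hG, hR, -, -, hK, -, -, -, hSe⟩ := x.sizes
  change 2 * g.edges.length + 1 ≤ layer k g.edges.length at hR
  change k * k < numColours k g.edges.length at hK
  have hFl : numColours k g.edges.length ≤ layer k g.edges.length :=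
    Nat.le_mul_of_pos_right _ (by omega)
  change stateCount k q g.edges.length = 2 * (k * layer k g.edges.length) +
    2 * layer k g.edges.length + q * layer k g.edges.length at hSe
  have a1 := hf.edges (2 * e) (by omega)
  have a2 := hf.edges (2 * e + 1) (by omega)
  have b1 := endpoints_lt g (i := 2 * e) (by omega)
  have b2 := endpoints_lt g (i := 2 * e + 1) (by omega)
  have c1 := hf.ids (2 * e) (by omega)
  have c2 := hf.ids (2 * e + 1) (by omega)
  have d1 := hid.lt (2 * e) (by omega)
  have d2 := hid.lt (2 * e + 1) (by omega)
  have e1 : (endpoints g).getD (2 * e) 0 < 2 * g.edges.length + 2 + g.numVertices := by omega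
  have hst : s ≤ t := ht ▸ Nat.div_le_self _ _
  have hh : s % numColours k g.edges.length ≤ s := Nat.mod_le _ _
  have hj : s / numColours k g.edges.length ≤ s := Nat.div_le_self _ _
  have h2e : e + e + 2 = 2 * e + 2 := by omega
  -- The input starts with two header words, so the endpoints of the edge `e` are at addresses `2 *
  -- e + 2` and `2 * e + 3`.
  have h2e' : 2 * e + 2 + 1 = 2 * e + 1 + 2 := by omega
  refine Ex.block (l := edgeHead (k * k)) ?_
  simp only [edgeHead, wp, BinOp.eval, Function.update_apply, reduceIte, Nat.reduceEqDiff,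
      OfNat.ofNat_ne_zero, OfNat.ofNat_ne_one, OfNat.zero_ne_ofNat, OfNat.one_ne_ofNat,
      one_ne_zero, zero_ne_one,
    hr.one, hr.two, show r 2 = g.edges.length from hr.edges,
    show r 5 = 2 * g.edges.length + 2 from hr.table,
    show r 10 = numColours k g.edges.length from hr.colours, h15, Nat.add_sub_cancel, ht, ht',
    h2e, h2e', layout_of_lt f l (show 2 * e + 2 < 2 * g.edges.length + 2 + g.numVertices by omega),
    layout_of_lt f l (show 2 * e + 1 + 2 < 2 * g.edges.length + 2 + g.numVertices by omega), a1, a2,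
    layout_of_lt f l (show (endpoints g).getD (2 * e) 0 + (2 * g.edges.length + 2) <
      2 * g.edges.length + 2 + g.numVertices by omega),
    layout_of_lt f l (show (endpoints g).getD (2 * e + 1) 0 + (2 * g.edges.length + 2) <
      2 * g.edges.length + 2 + g.numVertices by omega), c1, c2]
  refine ⟨by omega, by omega, by omega, by omega, by omega, by omega, by omega, by omega, by omega,
    by omega, by omega, by omega, by omega, by omega, by omega, by omega, trivial, trivial,
    trivial, trivial, trivial, rfl, rfl, trivial, trivial⟩

end

variable (x : Params)

theorem ex_edgeTail {w e s o b : ℕ} {f r : ℕ → ℕ} {l total rest : List ℕ} (hr : x.Regs r)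
    (he : e < x.m) (hs : s < x.k * numColours x.k x.m) (h16 : r 16 = s)
    (h20 : r 20 = x.eu e) (h21 : r 21 = x.ev e) (h23 : r 23 = b)
    (hb : 1 - (1 - b) = x.isBad s e) (h7 : r 7 = o + l.length)
    (hl : l ++ (flat [x.edge s e] ++ rest) = total) (hw : o + total.length < 2 ^ w)
    (hS : stateCount x.k x.q x.m < 2 ^ w) :
    Ex w (.block edgeTail) 15 r (layout f o l) (Writing f o total rest) := by
  obtain ⟨hG, hR, hFl, -, -, -, -, -, hSe⟩ := x.sizes
  have l1 := x.lt_layer hs (x.eu_lt e he)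
  have l2 := x.lt_layer (a := x.k + 1) (s := s + numColours x.k x.m)
    (by rw [Nat.succ_mul]; omega) (x.ev_lt e he)
  have l3 := x.edge_lt hs he
  simp only [edge] at l3
  have hk1 : (x.k + 1) * layer x.k x.m = x.k * layer x.k x.m + layer x.k x.m := by ring
  have hk2 : (2 * x.k + 2) * layer x.k x.m = 2 * (x.k * layer x.k x.m) + 2 * layer x.k x.m := by
    ring
  have hsF : s + numColours x.k x.m ≤ (s + numColours x.k x.m) * (2 * x.m + 1) :=
    Nat.le_mul_of_pos_right _ (by omega)
  have hlen := congrArg List.length hl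
  simp only [List.length_append, length_flat, List.length_cons, List.length_nil] at hlen
  refine Ex.block (l := edgeTail) ?_
  rw [edgeTail]
  simp only [List.cons_append, List.nil_append, wp, BinOp.eval, Function.update_apply,
      reduceIte, Nat.reduceEqDiff,
      OfNat.ofNat_ne_zero, OfNat.ofNat_ne_one, OfNat.zero_ne_ofNat, OfNat.one_ne_ofNat,
      one_ne_zero, zero_ne_one,
    hr.one, hr.ids, hr.colours, hr.dead, h16, h20, h21, h23, hb]
  refine ⟨by omega, by omega, by omega, by omega, by omega, by omega, by omega, by omega,
    by omega, ?_⟩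
  refine wp_emit (by decide) (by decide) ?_ ?_ (by omega) ?_
  · simp only [wp, BinOp.eval, Function.update_apply, reduceIte, Nat.reduceEqDiff,
      OfNat.ofNat_ne_zero, OfNat.ofNat_ne_one, OfNat.zero_ne_ofNat, OfNat.one_ne_ofNat,
      one_ne_zero, zero_ne_one, hr.one]
  · simp only [wp, BinOp.eval, Function.update_apply, reduceIte, Nat.reduceEqDiff,
      OfNat.ofNat_ne_zero, OfNat.ofNat_ne_one, OfNat.zero_ne_ofNat, OfNat.one_ne_ofNat,
      one_ne_zero, zero_ne_one, h7]
  · simp only [wp, BinOp.eval, Function.update_apply, reduceIte, Nat.reduceEqDiff,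
      OfNat.ofNat_ne_zero, OfNat.ofNat_ne_one, OfNat.zero_ne_ofNat, OfNat.one_ne_ofNat,
      one_ne_zero, zero_ne_one, hr.one]
    refine ⟨_, rfl, ?_, ?_⟩
    · simp only [wp, BinOp.eval, Function.update_apply, reduceIte, Nat.reduceEqDiff,
      OfNat.ofNat_ne_zero, OfNat.ofNat_ne_one, OfNat.zero_ne_ofNat, OfNat.one_ne_ofNat,
      one_ne_zero, zero_ne_one, List.length_append, List.length_cons, List.length_nil]
      omega
    · rw [← hl]
      simp [flat, edge]

/-- The counter of the loop encodes layer, colour and edge at once, in mixed radix. One round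
decodes it, counts violations and appends one transition. -/
theorem ex_edges {g : GraphInput} {id : ℕ → ℕ} (hid : Numbering g id) {k : ℕ} (hk : 0 < k) (q : ℕ)
    {w : ℕ} {f r m : ℕ → ℕ} {total : List ℕ} (hf : Tables g id f)
    (hr : (params g hid hk q).Regs r)
    (h15 : r 15 = k * numColours k g.edges.length * g.edges.length)
    (hwr : Writing f (2 * g.edges.length + 2 + g.numVertices) total
      (flat ((List.range (k * numColours k g.edges.length * g.edges.length)).reverse.map
        fun t => (params g hid hk q).edge (t / g.edges.length) (t % g.edges.length))) r m)
    (hw : 2 * g.edges.length + 2 + g.numVertices + total.length < 2 ^ w)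
    (htw : k * numColours k g.edges.length * g.edges.length < 2 ^ w)
    (hS : stateCount k q g.edges.length < 2 ^ w) :
    Ex w (.loop 15 (edgeBody (k * k)))
      (k * numColours k g.edges.length * g.edges.length * (16 + (k * k * 21 + 1 + 15) + 2) + 1) r m
      (Writing f (2 * g.edges.length + 2 + g.numVertices) total []) := by
  set x := params g hid hk q with hx
  set M := g.edges.length with hM
  set F := numColours k M with hF
  obtain ⟨hG, hR, hFl, hDF, hK, -, -, -, hSe⟩ := x.sizes
  change 2 * M + 1 ≤ layer k M at hR
  change F ≤ layer k M at hFl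
  change numTests M ≤ F at hDF
  change k * k < F at hK
  change stateCount k q M = 2 * (k * layer k M) + 2 * layer k M + q * layer k M at hSe
  refine Ex.mono (Ex.loop (t := 16 + (k * k * 21 + 1 + 15)) (n := k * F * M) (fun t r' m' =>
    r' 15 = t ∧ Writing f (2 * M + 2 + g.numVertices) total
      (flat ((List.range t).reverse.map fun t => x.edge (t / M) (t % M))) r' m')
      ?_ ?_ ?_) le_rfl ?_
  · exact ⟨h15, hwr⟩
  · exact fun r' m' h => h.1
  · rintro t r' m' ht ⟨g15, l, rfl, g7, hl⟩ hfr
    refine ⟨by omega, ?_⟩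
    have hr' := hr.frame fun d hd => hfr d (by rw [writes_edgeBody]; revert d; decide)
    have hM0 : 0 < M := by
      rcases Nat.eq_zero_or_pos M with h0 | h0
      · rw [h0] at ht
        omega
      · exact h0
    have hs : t / M < k * F := Nat.div_lt_of_lt_mul (by rwa [Nat.mul_comm])
    have he : t % M < M := Nat.mod_lt _ hM0
    have hev : x.ev (t % M) < 2 * M + 1 := x.ev_lt _ he
    have hst : t / M ≤ t := Nat.div_le_self _ _
    have hh : t / M % F ≤ t / M := Nat.mod_le _ _
    have hj : t / M / F ≤ t / M := Nat.div_le_self _ _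
    rw [List.range_succ, List.reverse_append, List.reverse_singleton, List.singleton_append,
      List.map_cons] at hl
    refine Ex.seq (ex_edgeHead hid hk q hf hr' he g15 rfl rfl (by omega) (by omega) hS)
      fun r₁ m₁ hf₁ ⟨hm₁, p15, p16, p18, p19, p20, p21, p22, p23⟩ => ?_
    subst hm₁
    have hr₁ := hr'.frame fun d hd => hf₁ d (by rw [writes_edgeHead]; revert d; decide)
    refine Ex.seq (ex_test hr₁.one hr₁.two hr₁.len hr₁.tests p19 p21 p22 p23 p18
      (lt_trans one_pos (numTests_pos _)) (lt_of_le_of_lt hj (by omega)) ?_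
      (lt_of_le_of_lt hh (by omega)) (by omega))
      fun r₂ m₂ hf₂ ⟨hm₂, q23⟩ => ?_
    · change x.ev (t % M) + numTests M < 2 ^ w
      omega
    subst hm₂
    have hr₂ := hr₁.frame fun d hd => hf₂ d (by revert d; decide)
    refine Ex.mono (x.ex_edgeTail (e := t % M) (s := t / M) hr₂ he hs
      ((hf₂ 16 (by decide)).trans p16) ((hf₂ 20 (by decide)).trans p20)
      ((hf₂ 21 (by decide)).trans p21) q23 rfl
      (((hf₂ 7 (by decide)).trans (hf₁ 7 (by rw [writes_edgeHead]; decide))).trans g7) hl (by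
          omega) hS) le_rfl
      fun r₃ m₃ hf₃ h => ⟨?_, h⟩
    rw [hf₃ 15 (by decide), hf₂ 15 (by decide), p15]
  · exact fun r' m' _ h => h.2

end Params

/-! ### The complete writing program -/

/-- Read the sizes of the graph and fix the addresses of the tables. -/
def readSizes : List Instr :=
  [.const 0 1, .const 1 2, .load 2 0, .load 3 39, .binop .add 4 2 2, .binop .add 4 4 0,
    .binop .add 5 4 0, .binop .add 6 5 3, .binop .sub 28 4 0]

/-- Compute the sizes of the instance and write its first six words. -/
def writeHeader (k p q : ℕ) : List Instr :=
  [.binop .mul 11 10 4, .const 8 k, .binop .mul 13 8 11, .binop .add 14 13 11,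
    .const 12 (2 * k + 2 + q), .binop .mul 12 12 11, .binop .sub 28 11 0, .binop .mul 24 28 1,
    .binop .mul 30 8 10, .binop .mul 30 30 2, .binop .add 24 24 30, .binop .add 26 12 24,
    .const 29 p, .binop .mul 29 29 26, .const 25 q, .binop .div 29 29 25, .binop .add 7 6 39] ++
    (emit 12 24 39 ++ (emit 29 13 29 ++ []))

/-- The program that writes the instance, for counter bound `n ↦ p * n / q`. -/
def writeInstance (k p q : ℕ) : Cmd :=
  (Cmd.block readSizes).seq <| (Cmd.loop 28 (.block idBody)).seq <|
  (Cmd.block [.binop .add 27 4 39]).seq <| (Cmd.loop 27 (.block sizeBody)).seq <|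
  (Cmd.block [.const 10 1, .const 28 (k * k)]).seq <| (Cmd.loop 28 (.block powBody)).seq <|
  (Cmd.block (writeHeader k p q)).seq <| (Cmd.loop 28 (.block Params.chainBody)).seq <|
  (Cmd.block [.binop .add 15 30 39]).seq (Cmd.loop 15 (Params.edgeBody (k * k)))

/-- The summands bound the consecutive commands of `writeInstance`, nested in the same way. -/
def writeTime (k m : ℕ) : ℕ :=
  9 + ((2 * m * 7 + 1) + (1 + (((2 * m + 1).size * 4 + 1) + (2 + ((k * k * 4 + 1) +
    (29 + (((layer k m - 1) * 18 + 1) + (1 +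
      (k * numColours k m * m * (16 + (k * k * 21 + 1 + 15) + 2) + 1)))))))))

theorem writes_writeHeader (k p q : ℕ) : (Cmd.block (writeHeader k p q)).writes =
    [11, 8, 13, 14, 12, 12, 28, 24, 30, 30, 24, 26, 29, 29, 25, 29, 7, 7, 7, 7, 7, 7, 7] := rfl

theorem Params.ex_writeHeader (x : Params) {γ : ℚ} (hγ : 0 < γ) (hq : x.q = γ.den) {w o : ℕ}
    {f r : ℕ → ℕ} (h0 : r 0 = 1) (h1 : r 1 = 2) (h2 : r 2 = x.m) (h4 : r 4 = 2 * x.m + 1)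
    (h6 : r 6 = o) (h10 : r 10 = numColours x.k x.m) (h39 : r 39 = 0)
    (hw : o + (6 + 3 * transCount x.k x.m) < 2 ^ w)
    (hS : γ.num.toNat * (stateCount x.k x.q x.m + transCount x.k x.m) < 2 ^ w) :
    Ex w (.block (writeHeader x.k γ.num.toNat x.q)) 29 r (layout f o []) fun r' m' =>
      r' 8 = x.k ∧ r' 13 = x.k * layer x.k x.m ∧ r' 14 = (x.k + 1) * layer x.k x.m ∧
      r' 28 = layer x.k x.m - 1 ∧ r' 30 = x.k * numColours x.k x.m * x.m ∧
      Writing f o (x.words γ) (flat x.triples) r' m' := by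
  obtain ⟨hG, hR, hFl, -, -, hkG, hk, hqG, hSe⟩ := x.sizes
  have hp : 1 ≤ γ.num.toNat := by
    have := Rat.num_pos.2 hγ
    omega
  have hn : stateCount x.k x.q x.m + transCount x.k x.m ≤
      γ.num.toNat * (stateCount x.k x.q x.m + transCount x.k x.m) := Nat.le_mul_of_pos_left _ hp
  have hpn : γ.num.toNat ≤ γ.num.toNat * (stateCount x.k x.q x.m + transCount x.k x.m) :=
    Nat.le_mul_of_pos_right _ (by omega)
  have hB := x.bound_eq γ hγ
  have hB' : x.bound γ ≤ γ.num.toNat * (stateCount x.k x.q x.m + transCount x.k x.m) := by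
    rw [hB]
    exact Nat.div_le_self _ _
  rw [vassSize, ← hq] at hB
  have hk1 : (x.k + 1) * layer x.k x.m = x.k * layer x.k x.m + layer x.k x.m := by ring
  have hT : (layer x.k x.m - 1) * 2 + x.k * numColours x.k x.m * x.m = transCount x.k x.m := rfl
  have hkF : x.k * numColours x.k x.m ≤ x.k * layer x.k x.m := Nat.mul_le_mul_left _ hFl
  have hSd : (2 * x.k + 2 + x.q) * layer x.k x.m = stateCount x.k x.q x.m := rfl
  have hGd : numColours x.k x.m * (2 * x.m + 1) = layer x.k x.m := rfl
  refine Ex.block (l := writeHeader x.k γ.num.toNat x.q) ?_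
  rw [writeHeader]
  simp only [List.cons_append, List.nil_append, wp, BinOp.eval, Function.update_apply,
      reduceIte, Nat.reduceEqDiff,
      OfNat.ofNat_ne_zero, OfNat.ofNat_ne_one, OfNat.zero_ne_ofNat, OfNat.one_ne_ofNat,
      one_ne_zero, zero_ne_one,
    h0, h1, h2, h4, h6, h10, h39, hGd, hSd, hT, ← hk1, ← hB, ← Nat.succ_mul, Nat.succ_eq_add_one,
    Nat.add_zero]
  refine ⟨by omega, by omega, by omega, by omega, by omega, by omega, by omega, by omega,
    by omega, by omega, by omega, by omega, by omega, by omega, by omega, by omega, by omega, ?_⟩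
  refine wp_emit (by decide) (by decide) ?_ ?_ ?_ ?_
  · simp only [wp, BinOp.eval, Function.update_apply, reduceIte, Nat.reduceEqDiff,
      OfNat.ofNat_ne_zero, OfNat.ofNat_ne_one, OfNat.zero_ne_ofNat, OfNat.one_ne_ofNat,
      one_ne_zero, zero_ne_one, h0]
  · simp only [wp, BinOp.eval, Function.update_apply, reduceIte, Nat.reduceEqDiff,
      OfNat.ofNat_ne_zero, OfNat.ofNat_ne_one, OfNat.zero_ne_ofNat, OfNat.one_ne_ofNat,
      one_ne_zero, zero_ne_one, List.length_nil, Nat.add_zero]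
  · simp only [List.length_nil]
    omega
  refine wp_emit (by decide) (by decide) ?_ ?_ ?_ ?_
  · simp only [wp, BinOp.eval, Function.update_apply, reduceIte, Nat.reduceEqDiff,
      OfNat.ofNat_ne_zero, OfNat.ofNat_ne_one, OfNat.zero_ne_ofNat, OfNat.one_ne_ofNat,
      one_ne_zero, zero_ne_one, h0]
  · simp only [wp, BinOp.eval, Function.update_apply, reduceIte, Nat.reduceEqDiff,
      OfNat.ofNat_ne_zero, OfNat.ofNat_ne_one, OfNat.zero_ne_ofNat, OfNat.one_ne_ofNat,
      one_ne_zero, zero_ne_one, List.length_append, List.length_cons, List.length_nil,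
          Nat.add_assoc]
  · simp only [List.length_append, List.length_cons, List.length_nil]
    omega
  simp only [wp, BinOp.eval, Function.update_apply, reduceIte, Nat.reduceEqDiff,
      OfNat.ofNat_ne_zero, OfNat.ofNat_ne_one, OfNat.zero_ne_ofNat, OfNat.one_ne_ofNat,
      one_ne_zero, zero_ne_one, h39]
  refine ⟨trivial, trivial, trivial, trivial, trivial, _, rfl, ?_, ?_⟩
  · simp only [wp, BinOp.eval, Function.update_apply, reduceIte, Nat.reduceEqDiff,
      OfNat.ofNat_ne_zero, OfNat.ofNat_ne_one, OfNat.zero_ne_ofNat, OfNat.one_ne_ofNat,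
      one_ne_zero, zero_ne_one, List.length_append, List.length_cons, List.length_nil,
          Nat.add_assoc]
  · simp [words, flat]

theorem ex_writeInstance (g : GraphInput) {k : ℕ} (hk : 0 < k) {γ : ℚ} (hγ : 0 < γ) {w : ℕ}
    (hw : 2 * g.edges.length + 2 + g.numVertices + (6 + 3 * transCount k g.edges.length) < 2 ^ w)
    (hS : γ.num.toNat * (stateCount k γ.den g.edges.length + transCount k g.edges.length) <
      2 ^ w) :
    Ex w (writeInstance k γ.num.toNat γ.den) (writeTime k g.edges.length) (fun _ => 0)
      (fun a => g.encode.getD a 0) fun r m => ∃ (id : ℕ → ℕ) (hid : Numbering g id),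
        r 6 = 2 * g.edges.length + 2 + g.numVertices ∧
        ∀ a, m (2 * g.edges.length + 2 + g.numVertices + a) =
          ((params g hid hk γ.den).words γ).getD a 0 := by
  set M := g.edges.length with hM
  set o := 2 * M + 2 + g.numVertices with ho
  have hm0 : g.encode.getD 0 0 = g.numVertices := rfl
  have hm1 : g.encode.getD 1 0 = M := rfl
  refine Ex.seq (Q₁ := fun r m => m = (fun a => g.encode.getD a 0) ∧ r 0 = 1 ∧ r 1 = 2 ∧ r 2 = M ∧
    r 4 = 2 * M + 1 ∧ r 5 = 2 * M + 2 ∧ r 6 = o ∧ r 28 = 2 * M) (Ex.block (l := readSizes) ?_)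
    fun r₁ m₁ f₁ ⟨hm₁, a0, a1, a2, a4, a5, a6, a28⟩ => ?_
  · simp only [readSizes, wp, BinOp.eval, Function.update_apply, reduceIte, Nat.reduceEqDiff,
      OfNat.ofNat_ne_zero, OfNat.ofNat_ne_one, OfNat.zero_ne_ofNat, OfNat.one_ne_ofNat,
      one_ne_zero, zero_ne_one, hm0, hm1]
    refine ⟨by omega, by omega, by omega, by omega, by omega, by omega, by omega, by omega,
      by omega, trivial, trivial, trivial, trivial, by omega, by omega, by omega, by omega⟩
  have z₁ : ∀ d, d ∉ (Cmd.block readSizes).writes → r₁ d = 0 := f₁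
  subst hm₁
  refine Ex.seq (ex_ids g a0 a1 a5 a28 (by omega)) fun r₂ m₂ f₂ ⟨id, f, hid, hf, hm₂⟩ => ?_
  subst hm₂
  set x := params g hid hk γ.den with hx
  have hxk : x.k = k := rfl
  have hxm : x.m = M := rfl
  have hxq : x.q = γ.den := rfl
  obtain ⟨hG, hR, hFl, hDF, hK, hkG, hkk, hqG, hSe⟩ := x.sizes
  rw [hxk, hxm] at hG hR hFl hDF hK hkG hkk hqG hSe
  rw [hxq] at hSe
  have hp : 1 ≤ γ.num.toNat := by
    have := Rat.num_pos.2 hγ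
    omega
  have hn : stateCount k γ.den M + transCount k M ≤
      γ.num.toNat * (stateCount k γ.den M + transCount k M) := Nat.le_mul_of_pos_left _ hp
  have hT : transCount k M = (layer k M - 1) * 2 + k * numColours k M * M := rfl
  have hD : numTests M = 2 * (2 * M + 1).size := rfl
  have hFD : numColours k M = numTests M ^ (k * k) := rfl
  have b0 := (f₂ 0 (by decide)).trans a0
  have b1 := (f₂ 1 (by decide)).trans a1
  have b2 := (f₂ 2 (by decide)).trans a2
  have b4 := (f₂ 4 (by decide)).trans a4
  have b5 := (f₂ 5 (by decide)).trans a5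
  have b6 := (f₂ 6 (by decide)).trans a6
  have b9 := (f₂ 9 (by decide)).trans (z₁ 9 (by decide))
  have b39 := (f₂ 39 (by decide)).trans (z₁ 39 (by decide))
  clear a0 a1 a2 a4 a5 a6 a28 f₁ f₂ z₁
  refine Ex.seq (Q₁ := fun r m => m = layout f o [] ∧ r 27 = 2 * M + 1) (Ex.block ?_)
    fun r₃ m₃ f₃ ⟨hm₃, c27⟩ => ?_
  · simp only [wp, BinOp.eval, Function.update_apply, reduceIte, Nat.reduceEqDiff,
      OfNat.ofNat_ne_zero, OfNat.ofNat_ne_one, OfNat.zero_ne_ofNat, OfNat.one_ne_ofNat,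
      one_ne_zero, zero_ne_one, b4, b39]
    exact ⟨by omega, rfl, trivial⟩
  subst hm₃
  refine Ex.seq (ex_size ((f₃ 0 (by decide)).trans b0) ((f₃ 1 (by decide)).trans b1)
    ((f₃ 9 (by decide)).trans b9) c27 (by omega) (by omega)) fun r₄ m₄ f₄ ⟨hm₄, d9⟩ => ?_
  subst hm₄
  refine Ex.seq (Q₁ := fun r m => m = layout f o [] ∧ r 10 = 1 ∧ r 28 = k * k) (Ex.block ?_)
    fun r₅ m₅ f₅ ⟨hm₅, e10, e28⟩ => ?_
  · simp only [wp, BinOp.eval, Function.update_apply, reduceIte, Nat.reduceEqDiff,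
      OfNat.ofNat_ne_zero, OfNat.ofNat_ne_one, OfNat.zero_ne_ofNat, OfNat.one_ne_ofNat,
      one_ne_zero, zero_ne_one]
    exact ⟨by omega, by omega, trivial, trivial, trivial⟩
  subst hm₅
  have g5 : ∀ d, d ∉ [27, 9, 10, 28] → r₅ d = r₂ d := by
    intro d hd
    simp only [List.mem_cons, List.not_mem_nil, not_or, or_false] at hd
    rw [f₅ d (by simp [Cmd.writes, Instr.writes, hd]),
      f₄ d (by simp [Cmd.writes, sizeBody, Instr.writes, hd]),
      f₃ d (by simp [Cmd.writes, Instr.writes, hd])]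
  have h59 : r₅ 9 = numTests M := (f₅ 9 (by simp [Cmd.writes, Instr.writes])).trans d9
  refine Ex.seq (ex_pow ((g5 0 (by decide)).trans b0) h59 e10 e28
    (lt_trans one_pos (numTests_pos _)) (by omega) (by omega)) fun r₆ m₆ f₆ ⟨hm₆, i10⟩ => ?_
  subst hm₆
  have g6 : ∀ d, d ∉ [27, 9, 10, 28] → r₆ d = r₂ d := by
    intro d hd
    rw [← g5 d hd]
    simp only [List.mem_cons, List.not_mem_nil, not_or, or_false] at hd
    exact f₆ d (by simp [Cmd.writes, powBody, Instr.writes, hd])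
  have h69 : r₆ 9 = numTests M := (f₆ 9 (by decide)).trans h59
  have i0 := (g6 0 (by decide)).trans b0
  have i1 := (g6 1 (by decide)).trans b1
  have i2 := (g6 2 (by decide)).trans b2
  have i4 := (g6 4 (by decide)).trans b4
  have i5 := (g6 5 (by decide)).trans b5
  have i6 := (g6 6 (by decide)).trans b6
  have i39 := (g6 39 (by decide)).trans b39
  have hlen : (x.words γ).length = 6 + 3 * transCount k M := by
    have h1 := length_flat x.triples
    rw [flat, x.length_triples] at h1
    rw [Params.words, List.length_append, h1]
    rfl
  refine Ex.seq (x.ex_writeHeader hγ rfl i0 i1 i2 i4 i6 i10 i39 hw hS)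
    fun r₇ m₇ f₇ ⟨j8, j13, j14, j28, j30, j⟩ => ?_
  rw [writes_writeHeader] at f₇
  have hr₇ : x.Regs r₇ := ⟨(f₇ 0 (by decide)).trans i0, (f₇ 1 (by decide)).trans i1,
    (f₇ 2 (by decide)).trans i2, (f₇ 4 (by decide)).trans i4, (f₇ 5 (by decide)).trans i5, j8,
    (f₇ 9 (by decide)).trans h69, (f₇ 10 (by decide)).trans i10, j13, j14,
    (f₇ 39 (by decide)).trans i39⟩
  have j6 := (f₇ 6 (by decide)).trans i6
  rw [Params.triples, flat, List.flatMap_append] at j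
  refine Ex.seq (x.ex_chain hr₇ j28 j (by omega) (lt_of_le_of_lt ?_ hS)) fun r₈ m₈ f₈ l => ?_
  · exact (Nat.le_add_right _ _).trans hn
  have hr₈ := hr₇.frame fun d hd => f₈ d (by revert d; decide)
  obtain ⟨L, rfl, l7, hL⟩ := l
  refine Ex.seq (Q₁ := fun r m => m = layout f o L ∧ r 15 = k * numColours k M * M) (Ex.block ?_)
    fun r₉ m₉ f₉ ⟨hm₉, n15⟩ => ?_
  · simp only [wp, BinOp.eval, Function.update_apply, reduceIte, Nat.reduceEqDiff,
      OfNat.ofNat_ne_zero, OfNat.ofNat_ne_one, OfNat.zero_ne_ofNat, OfNat.one_ne_ofNat,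
      one_ne_zero, zero_ne_one, f₈ 30 (by decide), hr₈.zero, j30]
    exact ⟨by rw [hxk, hxm]; omega, trivial, rfl⟩
  subst hm₉
  have hr₉ := hr₈.frame fun d hd => f₉ d (by revert d; decide)
  have hTw : k * numColours k M * M < 2 ^ w := by omega
  have hSw : stateCount k γ.den M < 2 ^ w := by omega
  refine Ex.mono (Params.ex_edges hid hk γ.den hf hr₉ n15
    ⟨L, rfl, (f₉ 7 (by decide)).trans l7, hL⟩ (by omega) hTw hSw) le_rfl ?_
  rintro r' m' fr ⟨l, rfl, -, hl⟩
  rw [List.append_nil] at hl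
  subst hl
  refine ⟨id, hid, ?_, fun a => ?_⟩
  · rw [fr 6 (by rw [Cmd.writes, Params.writes_edgeBody]; decide), f₉ 6 (by decide),
      f₈ 6 (by decide), j6]
  · rw [layout, if_neg (by omega), Nat.add_sub_cancel_left]

/-! ### Word sizes -/

/-- The size of the instance. -/
def sizeOfInst (k q m : ℕ) : ℕ := stateCount k q m + transCount k m

theorem numColours_mul_le (k m : ℕ) : k * numColours k m * m ≤ k * layer k m := by
  rw [layer, Nat.mul_assoc]
  exact Nat.mul_le_mul_left _ (Nat.mul_le_mul_left _ (by omega))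

theorem sizeOfInst_le (k q m : ℕ) : sizeOfInst k q m ≤ (3 * k + 4 + q) * layer k m := by
  have h := numColours_mul_le k m
  have h2 : (layer k m - 1) * 2 ≤ 2 * layer k m := by omega
  have e : (3 * k + 4 + q) * layer k m =
      (2 * k + 2 + q) * layer k m + 2 * layer k m + k * layer k m := by ring
  rw [sizeOfInst, stateCount, transCount, e]
  omega

theorem le_foldr_max {l : List ℕ} {a : ℕ} (h : a ∈ l) : a ≤ l.foldr max 0 := by
  induction l with
  | nil => simp at h
  | cons b l ih =>
    rcases List.mem_cons.1 h with rfl | h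
    · exact le_max_left _ _
    · exact (ih h).trans (le_max_right _ _)

theorem foldr_max_le {l : List ℕ} {b : ℕ} (h : ∀ a ∈ l, a ≤ b) : l.foldr max 0 ≤ b := by
  induction l with
  | nil => exact Nat.zero_le _
  | cons a l ih =>
    exact max_le (h a (List.mem_cons_self ..)) (ih fun c hc => h c (List.mem_cons_of_mem _ hc))

theorem lt_two_pow_inputBits (g : GraphInput) :
    2 * g.edges.length + 2 + g.numVertices < 2 ^ inputBits g.encode := by
  have h1 : g.encode.length = 2 * g.edges.length + 2 := by
    have := length_endpoints g
    rw [endpoints] at this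
    rw [GraphInput.encode, List.length_append, this]
    simp [Nat.add_comm]
  have h2 : g.numVertices ≤ g.encode.foldr max 0 := le_foldr_max (by simp [GraphInput.encode])
  refine lt_of_le_of_lt ?_ (Nat.lt_size_self _)
  omega

theorem size_le_self (n : ℕ) : n.size ≤ n := Nat.size_le.2 Nat.lt_two_pow_self

theorem two_pow_size_le {n : ℕ} (hn : 0 < n) : 2 ^ n.size ≤ 2 * n := by
  obtain ⟨s, hs⟩ : ∃ s, n.size = s + 1 := ⟨n.size - 1, by have := Nat.size_pos.2 hn; omega⟩
  have : 2 ^ s ≤ n := Nat.lt_size.1 (by omega)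
  rw [hs, pow_succ]
  omega

/-- Every word of the instance is at most `γ.num` times its size, and there are `6 + 3 * transCount`
words, at most nine times the size. -/
theorem Params.two_pow_inputBits_le (x : Params) {γ : ℚ} (hγ : 0 < γ) :
    2 ^ inputBits (x.inst γ).encode ≤
      2 * (9 + γ.num.toNat) * sizeOfInst x.k x.q x.m := by
  have hp : 1 ≤ γ.num.toNat := by
    have := Rat.num_pos.2 hγ
    omega
  obtain ⟨hG, -, -, -, -, -, -, -, hSe⟩ := x.sizes
  have hV : stateCount x.k x.q x.m + transCount x.k x.m = sizeOfInst x.k x.q x.m := rfl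
  have hn : sizeOfInst x.k x.q x.m ≤ γ.num.toNat * sizeOfInst x.k x.q x.m :=
    Nat.le_mul_of_pos_left _ hp
  have hB : x.bound γ ≤ γ.num.toNat * sizeOfInst x.k x.q x.m := by
    rw [x.bound_eq γ hγ]
    exact Nat.div_le_self _ _
  have hlast := x.last_lt
  have hlen : (x.words γ).length = 6 + 3 * transCount x.k x.m := by
    have h1 := length_flat x.triples
    rw [flat, x.length_triples] at h1
    rw [Params.words, List.length_append, h1]
    rfl
  have hmax : (x.words γ).foldr max 0 ≤ γ.num.toNat * sizeOfInst x.k x.q x.m := by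
    refine foldr_max_le fun a ha => ?_
    rw [words, List.mem_append] at ha
    rcases ha with ha | ha
    · simp only [List.mem_cons, List.not_mem_nil, or_false] at ha
      omega
    · obtain ⟨t, ht, ha⟩ := List.mem_flatMap.1 ha
      obtain ⟨h1, h2, h3⟩ := x.triples_lt ht
      simp only [List.mem_cons, List.not_mem_nil, or_false] at ha
      omega
  rw [encode_inst, inputBits]
  refine (two_pow_size_le (by omega)).trans ?_
  rw [hlen, Nat.mul_assoc, Nat.add_mul]
  omega

/-- Number of words of the input size that suffices for all values. -/
def wordFactor (k p q c : ℕ) : ℕ :=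
  (2 * (9 + p) * (3 * k + 4 + q) + (2 * (k * k) + 1)) * (c + 1) + 2

/-- With `Y = 2 ^ y`, there are at most `Y ^ 2` tests, hence a layer has at most `Y ^ (2 * (k * k) +
1)` states and the instance has size polynomial in `Y`. Its word length is thus a constant multiple
of `y`. The final `+ 2` in `wordFactor` leaves a factor of at least `4` for adding up the terms. -/
theorem wordFactor_spec (g : GraphInput) {k p q c y : ℕ} (hp : 0 < p)
    (hy : y = inputBits g.encode) {z : ℕ}
    (hz : 2 ^ z ≤ 2 * (9 + p) * sizeOfInst k q g.edges.length) :
    2 * g.edges.length + 2 + g.numVertices + (6 + 3 * transCount k g.edges.length) <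
        2 ^ (wordFactor k p q c * y) ∧
      p * sizeOfInst k q g.edges.length < 2 ^ (wordFactor k p q c * y) ∧
      2 * g.edges.length + 2 + g.numVertices + 2 ^ (c * z) ≤ 2 ^ (wordFactor k p q c * y) := by
  have hY := lt_two_pow_inputBits g
  rw [← hy] at hY
  set M := g.edges.length with hM
  set Y := 2 ^ y with hYdef
  have hY2 : 2 ≤ Y := by omega
  set V := sizeOfInst k q M with hV
  set c₀ := 2 * (9 + p) * (3 * k + 4 + q) with hc₀
  set e := 2 * (k * k) + 1 with he
  have hlayer : layer k M ≤ Y ^ e := by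
    have h1 : numTests M ≤ Y ^ 2 := by
      have := size_le_self (2 * M + 1)
      rw [numTests, pow_two]
      calc 2 * (2 * M + 1).size ≤ Y * (2 * M + 1) := Nat.mul_le_mul hY2 this
        _ ≤ Y * Y := Nat.mul_le_mul_left _ (by omega)
    rw [layer, he, pow_succ]
    refine Nat.mul_le_mul ?_ (by omega)
    rw [numColours, pow_mul Y]
    exact Nat.pow_le_pow_left h1 _
  have hbig : 2 * (9 + p) * V ≤ Y ^ (c₀ + e) := by
    calc 2 * (9 + p) * V ≤ 2 * (9 + p) * ((3 * k + 4 + q) * layer k M) :=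
          Nat.mul_le_mul_left _ (sizeOfInst_le k q M)
      _ = c₀ * layer k M := by rw [hc₀]; ring
      _ ≤ Y ^ c₀ * Y ^ e := Nat.mul_le_mul (Nat.lt_pow_self (by omega)).le hlayer
      _ = Y ^ (c₀ + e) := (pow_add _ _ _).symm
  have hpow : 2 ^ (wordFactor k p q c * y) = Y ^ ((c₀ + e) * (c + 1)) * (Y * Y) := by
    rw [Nat.mul_comm, pow_mul, wordFactor, pow_add, pow_two]
  have h1 : Y ^ (c₀ + e) ≤ Y ^ ((c₀ + e) * (c + 1)) :=
    Nat.pow_le_pow_right (by omega) (Nat.le_mul_of_pos_right _ (by omega))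
  have h2 : 2 ^ (c * z) ≤ Y ^ ((c₀ + e) * (c + 1)) := by
    calc 2 ^ (c * z) = (2 ^ z) ^ c := by rw [Nat.mul_comm, pow_mul]
      _ ≤ (Y ^ (c₀ + e)) ^ c := Nat.pow_le_pow_left (hz.trans hbig) _
      _ = Y ^ ((c₀ + e) * c) := by rw [← pow_mul]
      _ ≤ _ := Nat.pow_le_pow_right (by omega) (Nat.mul_le_mul_left _ (by omega))
  have hYX : Y ≤ Y ^ ((c₀ + e) * (c + 1)) := Nat.le_self_pow (by positivity) _
  have h4 : 2 * 2 ≤ Y * Y := Nat.mul_le_mul hY2 hY2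
  have h5 : Y ^ ((c₀ + e) * (c + 1)) * 4 ≤ 2 ^ (wordFactor k p q c * y) := by
    rw [hpow]
    exact Nat.mul_le_mul_left _ h4
  have hVs : stateCount k q M + transCount k M = V := rfl
  have e1 : 2 * (9 + p) * V = 18 * V + 2 * (p * V) := by ring
  have hVpos : 0 < V := by
    refine Nat.pos_of_ne_zero fun h => ?_
    rw [h] at hz
    simp at hz
  refine ⟨by omega, by omega, by omega⟩

/-! ### The reduction as a program -/

/-- Write the instance, then run `P` on it. -/
def fullProgram (k p q : ℕ) (P : Program) : Program :=
  (writeInstance k p q).compile 0 ++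
    Program.shift (writeInstance k p q).len 40 6 31 0 P

/-- A program that solves a problem between reachability and coverability yields one for
`k`-cycles. -/
theorem solvableInTime_kCycle {k : ℕ} (hk : 0 < k) {γ : ℚ} (hγ : 0 < γ)
    {yes : BoundedVASSInput (linearBound γ) 1 → Prop}
    (hreach : ∀ x, (reachabilityProblem (linearBound γ) 1).yes x → yes x)
    (hcover : ∀ x, yes x → (coverabilityProblem (linearBound γ) 1).yes x) {T : ℕ → ℕ}
    (hT : (DecisionProblem.mk (BoundedVASSInput (linearBound γ) 1) BoundedVASSInput.encode
      (fun x => x.vass.size) yes).SolvableInTime T) :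
    (kCycleProblem k).SolvableInTime
      fun m => writeTime k m + 2 * T (sizeOfInst k γ.den m) := by
  obtain ⟨P, c, hP⟩ := hT
  have hp : 0 < γ.num.toNat := by
    have := Rat.num_pos.2 hγ
    omega
  refine ⟨fullProgram k γ.num.toNat γ.den P, wordFactor k γ.num.toNat γ.den c, fun g => ?_⟩
  change GraphInput at g
  change ∃ b, run _ (_ * inputBits g.encode) (writeTime k g.edges.length +
    2 * T (sizeOfInst k γ.den g.edges.length)) (initial g.encode) = some b ∧
      (b = true ↔ g.graph.HasKCycle k)
  -- Only the first two bounds are used here; they do not involve `z`, and the instance is not yet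
  -- available because its numbering comes from the run of the writer.
  have hw₀ := wordFactor_spec g (k := k) (q := γ.den) (c := c) hp rfl (z := 0) (by
    have : 0 < sizeOfInst k γ.den g.edges.length := by
      have := layer_gt_one hk g.edges.length
      rw [sizeOfInst, stateCount]
      positivity
    have : 0 < 2 * (9 + γ.num.toNat) * sizeOfInst k γ.den g.edges.length := by positivity
    rw [pow_zero]
    exact this)
  have hcode : CodeAt (fullProgram k γ.num.toNat γ.den P) 0
      (fullProgram k γ.num.toNat γ.den P) := fun i _ => by rw [Nat.zero_add]
  obtain ⟨t, ht, r, m, ⟨id, hid, h6, hm⟩, hf, hl⟩ :=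
    ex_writeInstance g hk hγ hw₀.1 hw₀.2.1 _ 0 hcode.left
  set x := params g hid hk γ.den with hx
  have hw := wordFactor_spec g (k := k) (q := γ.den) (c := c) hp rfl
    (z := inputBits (x.inst γ).encode) (x.two_pow_inputBits_le hγ)
  obtain ⟨b, hb, hyes⟩ := hP (x.inst γ)
  simp only at hb hyes
  have hsize : (x.inst γ).vass.size = sizeOfInst k γ.den g.edges.length := x.size_vass
  rw [hsize] at hb
  have hwrites : ∀ d ∈ (writeInstance k γ.num.toNat γ.den).writes, d < 40 := by
    -- The written registers do not depend on the constants in the code, so a closed instance can be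
    -- decided. Registers from `40` on are hence still zero, as the initial state of the simulated
    -- program requires.
    have : (writeInstance k γ.num.toNat γ.den).writes = (writeInstance 0 0 0).writes := rfl
    rw [this]
    decide
  have hrep : Represents (writeInstance k γ.num.toNat γ.den).len 40 6
      (2 * g.edges.length + 2 + g.numVertices) (c * inputBits (x.inst γ).encode)
      (initial (x.inst γ).encode) ⟨0 + (writeInstance k γ.num.toNat γ.den).len, r, m⟩ := by
    refine ⟨by simp [initial], fun d => ?_, h6, fun a => ?_, fun d => Nat.two_pow_pos _⟩
    · exact hf _ fun h => by have := hwrites _ h; omega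
    · rw [x.encode_inst]
      exact hm a
  have hright := hcode.right
  rw [Cmd.length_compile, Nat.zero_add] at hright
  have hrun := hrep.run (by decide) (by decide) (by decide) hw.2.2 hright hb
  refine ⟨b, ?_, ?_⟩
  · rw [← hl] at hrun
    have := run_mono _ _ _ (writeTime k g.edges.length - t) _ _ hrun
    rw [← this]
    congr 1
    omega
  · rw [hyes]
    constructor
    · intro h
      obtain ⟨v, hv, hr⟩ := hcover _ h
      exact hasKCycle_of_cover hid hk γ.den hv hr
    · exact fun h => hreach _ (reach_of_hasKCycle hid hk γ.den hγ rfl h)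

/-- The empty cycle exists in every graph. This rules out `k = 0` as a witness of the hypothesis. -/
theorem solvableInTime_zeroCycle : (kCycleProblem 0).SolvableInTime fun _ => 1 :=
  ⟨[.accept], 0, fun _ => ⟨true, rfl, by
    simp only [true_iff]
    exact ⟨fun i => i.elim0, fun i => i.elim0, fun i => i.elim0⟩⟩⟩

open Asymptotics Filter

/-! ### Running times -/

theorem size_le_log {n : ℕ} (hn : 0 < n) : (n.size : ℝ) ≤ Real.log n / Real.log 2 + 1 := by
  obtain ⟨s, hs⟩ : ∃ s, n.size = s + 1 := ⟨n.size - 1, by have := Nat.size_pos.2 hn; omega⟩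
  have h : 2 ^ s ≤ n := Nat.lt_size.1 (by omega)
  have h2 : ((2 : ℝ) ^ s) ≤ n := by exact_mod_cast h
  have h3 := Real.log_le_log (by positivity) h2
  rw [Real.log_pow] at h3
  have hlog : 0 < Real.log 2 := Real.log_pos one_lt_two
  rw [hs, Nat.cast_add, Nat.cast_one]
  gcongr
  rwa [le_div_iff₀ hlog]

/-- The number of states in a layer is almost linear in the number of edges. -/
theorem exists_layer_le {k : ℕ} (hk : 0 < k) {δ : ℝ} (hδ : 0 < δ) :
    ∃ C : ℝ, 0 < C ∧ ∀ m : ℕ, 1 ≤ m → (layer k m : ℝ) ≤ C * (m : ℝ) ^ (1 + δ) := by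
  set K : ℕ := k * k with hK
  have hKpos : (0 : ℝ) < K := by
    rw [hK]
    positivity
  -- A logarithm is `O(m ^ η)`, so its `K`-th power costs only `m ^ δ`.
  set η : ℝ := δ / K with hη
  have hηpos : 0 < η := by positivity
  have hlog : 0 < Real.log 2 := Real.log_pos one_lt_two
  set A : ℝ := 3 ^ η / η / Real.log 2 + 1 with hA
  have hApos : 0 < A := by positivity
  refine ⟨(2 * A) ^ K * 3, by positivity, fun m hm => ?_⟩
  have hm1 : (1 : ℝ) ≤ m := by exact_mod_cast hm
  have hm0 : (0 : ℝ) < m := by linarith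
  have hmη : (1 : ℝ) ≤ (m : ℝ) ^ η := Real.one_le_rpow hm1 hηpos.le
  have hR : ((2 * m + 1 : ℕ) : ℝ) ≤ 3 * m := by
    push_cast
    linarith
  have hsize : ((2 * m + 1).size : ℝ) ≤ A * (m : ℝ) ^ η := by
    refine (size_le_log (Nat.succ_pos _)).trans ?_
    have h1 : Real.log ((2 * m + 1 : ℕ) : ℝ) ≤ 3 ^ η / η * (m : ℝ) ^ η := by
      refine (Real.log_le_log (by positivity) hR).trans ?_
      refine (Real.log_le_rpow_div (by positivity) hηpos).trans ?_
      rw [Real.mul_rpow (by norm_num) hm0.le]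
      exact le_of_eq (by ring)
    calc Real.log ((2 * m + 1 : ℕ) : ℝ) / Real.log 2 + 1
        ≤ 3 ^ η / η * (m : ℝ) ^ η / Real.log 2 + (m : ℝ) ^ η := by gcongr
      _ = A * (m : ℝ) ^ η := by rw [hA]; ring
  calc (layer k m : ℝ) = (2 * ((2 * m + 1).size : ℝ)) ^ K * ((2 * m + 1 : ℕ) : ℝ) := by
        rw [layer, numColours, numTests]
        push_cast
        rfl
    _ ≤ (2 * (A * (m : ℝ) ^ η)) ^ K * (3 * m) := by gcongr
    _ = (2 * A) ^ K * 3 * (((m : ℝ) ^ η) ^ K * m) := by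
        rw [← mul_assoc 2 A, mul_pow]
        ring
    _ = (2 * A) ^ K * 3 * (m : ℝ) ^ (1 + δ) := by
        rw [← Real.rpow_natCast (_ ^ η), ← Real.rpow_mul hm0.le, hη, div_mul_cancel₀ _ hKpos.ne',
          add_comm, Real.rpow_add_one hm0.ne']

theorem writeTime_le {k : ℕ} (hk : 0 < k) (m : ℕ) :
    writeTime k m ≤ (80 + k * (21 * (k * k) + 34)) * layer k m := by
  have hF := numColours_gt_one hk m
  have hG := layer_gt_one hk m
  have hD := numTests_pos m
  have hR : 2 * m + 1 ≤ layer k m := Nat.le_mul_of_pos_left _ (by omega)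
  have hFG : numColours k m ≤ layer k m := Nat.le_mul_of_pos_right _ (by omega)
  have hK : k * k < numColours k m := Nat.lt_pow_self hD
  have hDF : numTests m ≤ numColours k m := Nat.le_self_pow (Nat.mul_pos hk hk).ne' _
  have hs : 2 * (2 * m + 1).size = numTests m := rfl
  have h1 := Nat.mul_le_mul_right (16 + (k * k * 21 + 1 + 15) + 2) (numColours_mul_le k m)
  have e : (80 + k * (21 * (k * k) + 34)) * layer k m =
      80 * layer k m + k * layer k m * (16 + (k * k * 21 + 1 + 15) + 2) := by ring
  rw [writeTime, e]
  omega

/-- With layers of size `O(m ^ (1 + ε / 4))` the exponent of the solver becomes `(1 + ε / 4) * (2 -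
ε)`, which is at most `2 - ε / 2`. Writing the instance takes time linear in a layer, and `ε ≤ 1`
gives `1 + ε / 4 ≤ 2 - ε / 2`. -/
theorem isBigO_time {k : ℕ} (hk : 0 < k) (q : ℕ) {ε : ℝ} (hε : 0 < ε) (hε1 : ε ≤ 1) {T : ℕ → ℕ}
    (hT : (fun n : ℕ => (T n : ℝ)) =O[atTop] fun n : ℕ => (n : ℝ) ^ (2 - ε)) :
    (fun m : ℕ => ((writeTime k m + 2 * T (sizeOfInst k q m) : ℕ) : ℝ)) =O[atTop]
      fun m : ℕ => (m : ℝ) ^ (2 - ε / 2) := by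
  obtain ⟨C, hC, hCl⟩ := exists_layer_le hk (δ := ε / 4) (by positivity)
  -- Over the naturals the bound holds at every argument where the comparison function is non-zero,
  -- so it applies to the size of the instance without a limit argument.
  obtain ⟨C₂, hC₂, hT⟩ := bound_of_isBigO_nat_atTop hT
  set c₁ : ℕ := 80 + k * (21 * (k * k) + 34) with hc₁
  set c₀ : ℕ := 3 * k + 4 + q with hc₀
  refine IsBigO.of_bound (c₁ * C + 2 * (C₂ * (c₀ * C) ^ (2 - ε))) ?_
  filter_upwards [eventually_ge_atTop 1] with m hm
  have hm1 : (1 : ℝ) ≤ m := by exact_mod_cast hm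
  have hm0 : (0 : ℝ) < m := by linarith
  rw [Real.norm_of_nonneg (by positivity), Real.norm_of_nonneg (by positivity)]
  have hl := hCl m hm
  have hw : (writeTime k m : ℝ) ≤ c₁ * C * (m : ℝ) ^ (2 - ε / 2) := by
    calc (writeTime k m : ℝ) ≤ c₁ * layer k m := by exact_mod_cast writeTime_le hk m
      _ ≤ c₁ * (C * (m : ℝ) ^ (1 + ε / 4)) := by gcongr
      _ ≤ c₁ * (C * (m : ℝ) ^ (2 - ε / 2)) := by
          gcongr
          linarith
      _ = _ := by ring
  have hn : (0 : ℝ) < (sizeOfInst k q m : ℝ) := by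
    have := layer_gt_one hk m
    rw [sizeOfInst, stateCount]
    positivity
  have ht : (T (sizeOfInst k q m) : ℝ) ≤ C₂ * (c₀ * C) ^ (2 - ε) * (m : ℝ) ^ (2 - ε / 2) := by
    have h := hT (x := sizeOfInst k q m) (Real.rpow_pos_of_pos hn _).ne'
    rw [Real.norm_of_nonneg (by positivity), Real.norm_of_nonneg (by positivity)] at h
    refine h.trans ?_
    have hs : (sizeOfInst k q m : ℝ) ≤ c₀ * C * (m : ℝ) ^ (1 + ε / 4) := by
      calc (sizeOfInst k q m : ℝ) ≤ c₀ * layer k m := by exact_mod_cast sizeOfInst_le k q m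
        _ ≤ c₀ * (C * (m : ℝ) ^ (1 + ε / 4)) := by gcongr
        _ = _ := by ring
    calc C₂ * (sizeOfInst k q m : ℝ) ^ (2 - ε)
        ≤ C₂ * (c₀ * C * (m : ℝ) ^ (1 + ε / 4)) ^ (2 - ε) := by
          gcongr
          linarith
      _ = C₂ * (c₀ * C) ^ (2 - ε) * (m : ℝ) ^ ((1 + ε / 4) * (2 - ε)) := by
          rw [Real.mul_rpow (by positivity) (by positivity), ← Real.rpow_mul hm0.le]
          ring
      _ ≤ _ := by
          gcongr
          nlinarith
  push_cast
  linarith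

/-- Any answer implied by reachability and implying coverability is correct on the constructed
instances. Replacing `ε` by `min ε 1` only weakens the assumed running time. -/
theorem not_solvableInTimeBigO (hypothesis : KCycleHypothesis) {γ : ℚ} (hγ : 0 < γ) {ε : ℝ}
    (hε : 0 < ε) {yes : BoundedVASSInput (linearBound γ) 1 → Prop}
    (hreach : ∀ x, (reachabilityProblem (linearBound γ) 1).yes x → yes x)
    (hcover : ∀ x, yes x → (coverabilityProblem (linearBound γ) 1).yes x) :
    ¬ (DecisionProblem.mk (BoundedVASSInput (linearBound γ) 1) BoundedVASSInput.encode
      (fun x => x.vass.size) yes).SolvableInTimeBigO (2 - ε) := by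
  rintro ⟨T, hT, hsolve⟩
  set ε₀ := min ε 1 with hε₀
  have hpos : 0 < ε₀ := lt_min hε one_pos
  have hle1 : ε₀ ≤ 1 := min_le_right _ _
  obtain ⟨k, hk⟩ := hypothesis (ε₀ / 2) (by positivity)
  apply hk
  rcases Nat.eq_zero_or_pos k with rfl | hkpos
  · refine ⟨fun _ => 1, IsBigO.of_bound 1 ?_, solvableInTime_zeroCycle⟩
    filter_upwards [eventually_ge_atTop 1] with m hm
    have hm1 : (1 : ℝ) ≤ m := by exact_mod_cast hm
    have := Real.one_le_rpow hm1 (show 0 ≤ 2 - ε₀ / 2 by linarith)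
    rw [Real.norm_of_nonneg (by positivity), Real.norm_of_nonneg (by positivity)]
    simpa using this
  · refine ⟨_, isBigO_time hkpos γ.den hpos hle1 (hT.trans (IsBigO.of_bound 1 ?_)),
      solvableInTime_kCycle hkpos hγ hreach hcover hsolve⟩
    filter_upwards [eventually_ge_atTop 1] with m hm
    have hm1 : (1 : ℝ) ≤ m := by exact_mod_cast hm
    rw [Real.norm_of_nonneg (by positivity), Real.norm_of_nonneg (by positivity), one_mul]
    exact Real.rpow_le_rpow_of_exponent_le hm1 (by linarith [min_le_left ε 1])

end CycleReduction

theorem mainTheorem4 (hypothesis : KCycleHypothesis) (γ : ℚ) (hγ : 0 < γ)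
    (ε : ℝ) (hε : 0 < ε) :
    ¬ (reachabilityProblem (linearBound γ) 1).SolvableInTimeBigO (2 - ε) ∧
      ¬ (coverabilityProblem (linearBound γ) 1).SolvableInTimeBigO (2 - ε) :=
  ⟨CycleReduction.not_solvableInTimeBigO hypothesis hγ hε (fun _ h => h)
    fun x h => ⟨x.target.2, fun _ => le_rfl, h⟩,
    CycleReduction.not_solvableInTimeBigO hypothesis hγ hε
      (fun x h => ⟨x.target.2, fun _ => le_rfl, h⟩) fun _ h => h⟩
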